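/- Let $n\ge 0$ and let $w\in S_{n+1}$ be a permutation, $S_{n+1}$ being generated by the simple reflections $s_1,\dots,s_n$, where $s_i$ swaps $i$ and $i+1$. Let $R(w)$ be the set of reduced words of $w$, that is, the shortest words $i_1i_2\cdots i_k$ with $w=s_{i_1}s_{i_2}\cdots s_{i_k}$. Let $C(w)$ be the set of commutation classes of $w$ (the classes of $R(w)$ under the moves replacing a factor $ab$ with $|a-b|>1$ by $ba$), and let $B(w)$ be the set of braid classes of $w$ (the classes of $R(w)$ under the moves replacing a factor $aba$ with $|a-b|=1$ by $bab$). Let $\Gamma(w)$ be the bipartite graph whose vertices are the elements of the disjoint union $B(w)\sqcup C(w)$, with an edge between $B\in B(w)$ and $C\in C(w)$ if and only if $B\cap C\neq\emptyset$; call $w$ circuit-free if $\Gamma(w)$ contains no circuit. Then $w$ is circuit-free if and only if it attains the lower bound $|R(w)|=|B(w)|+|C(w)|-1$, and this holds if and only if at least one of the following holds: 1. $|B(w)|=1$; 2. $|C(w)|=1$; 3. $w$ has a reduced word that, up to reversal ($i_1\cdots i_k\mapsto i_k\cdots i_1$), complementation ($i_1\cdots i_k\mapsto (n+1-i_1)\cdots(n+1-i_k)$)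 or the composition of both, is of the form $\mathbf{u}\,i(i+1)i\,\mathbf{v}$, where one of the following conditions holds: - $\mathbf{u}=\emptyset$, and $\mathbf{v}=(i-1)i$ or $\mathbf{v}=(i-1)(i-2)\cdots(i-1-t)$ for some integer $t\ge 0$; - $\mathbf{u}=\mathbf{v}=i-1$; - $\mathbf{u}=(i-1-t)\cdots(i-2)(i-1)$ and $\mathbf{v}=(i+2)(i+3)\cdots(i+2+t')$ for some integers $t,t'\ge 0$. -/

import Mathlib

namespace ReducedWords

/-- The simple reflection swapping the adjacent positions `a` and `a + 1` of `{0, …, n}`.  The symmetric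
group on `n + 1` letters is `Equiv.Perm (Fin (n + 1))`; its `n` simple reflections are indexed by
`Fin n`, and the index `a : Fin n` stands for the customary (one-based) letter `a + 1 ∈ {1, …, n}`. -/
def simpleReflection {n : ℕ} (a : Fin n) : Equiv.Perm (Fin (n + 1)) :=
  Equiv.swap a.castSucc a.succ

/-- The permutation `s_{i₁} s_{i₂} ⋯ s_{i_k}` expressed by the word `i₁ i₂ ⋯ i_k`. -/
def wordProd {n : ℕ} (x : List (Fin n)) : Equiv.Perm (Fin (n + 1)) :=
  (x.map simpleReflection).prod

/-- `R(w)`: the set of reduced words of `w`, i.e. the shortest words expressing `w`. -/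
def reducedWords {n : ℕ} (w : Equiv.Perm (Fin (n + 1))) : Set (List (Fin n)) :=
  {x | wordProd x = w ∧ ∀ y : List (Fin n), wordProd y = w → x.length ≤ y.length}

/-- There are finitely many reduced words, so that the cardinalities used below are genuine. -/
theorem finite_reducedWords {n : ℕ} (w : Equiv.Perm (Fin (n + 1))) : (reducedWords w).Finite := by
  rcases (reducedWords w).eq_empty_or_nonempty with h | ⟨x, hx⟩
  · rw [h]
    exact Set.finite_empty
  · exact (List.finite_length_le (Fin n) x.length).subset fun y hy => hy.2 x hx.1

/-- A single commutation move: a factor `a b` with `|a - b| > 1` is replaced by `b a`. -/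
def CommutationMove {n : ℕ} (x y : List (Fin n)) : Prop :=
  ∃ (p q : List (Fin n)) (a b : Fin n), ((a : ℕ) + 1 < b ∨ (b : ℕ) + 1 < a) ∧
    x = p ++ [a, b] ++ q ∧ y = p ++ [b, a] ++ q

/-- A single braid move: a factor `a b a` with `|a - b| = 1` is replaced by `b a b`. -/
def BraidMove {n : ℕ} (x y : List (Fin n)) : Prop :=
  ∃ (p q : List (Fin n)) (a b : Fin n), ((a : ℕ) + 1 = b ∨ (b : ℕ) + 1 = a) ∧
    x = p ++ [a, b, a] ++ q ∧ y = p ++ [b, a, b] ++ q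

/-- Two reduced words of `w` are equivalent if a sequence of commutation moves joins them. -/
def commutationSetoid {n : ℕ} (w : Equiv.Perm (Fin (n + 1))) : Setoid (reducedWords w) :=
  Relation.EqvGen.setoid (fun x y => CommutationMove x.1 y.1)

/-- Two reduced words of `w` are equivalent if a sequence of braid moves joins them. -/
def braidSetoid {n : ℕ} (w : Equiv.Perm (Fin (n + 1))) : Setoid (reducedWords w) :=
  Relation.EqvGen.setoid (fun x y => BraidMove x.1 y.1)

/-- `C(w)`: the commutation classes of `w`. -/
abbrev CommutationClasses {n : ℕ} (w : Equiv.Perm (Fin (n + 1))) : Type :=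
  Quotient (commutationSetoid w)

/-- `B(w)`: the braid classes of `w`. -/
abbrev BraidClasses {n : ℕ} (w : Equiv.Perm (Fin (n + 1))) : Type :=
  Quotient (braidSetoid w)

/-- `Γ(w)`: the bipartite graph whose vertices are the braid classes and the commutation classes of `w`
(as a disjoint union), a braid class and a commutation class being adjacent if and only if they have
a reduced word in common. -/
def classGraph {n : ℕ} (w : Equiv.Perm (Fin (n + 1))) :
    SimpleGraph (BraidClasses w ⊕ CommutationClasses w) :=
  SimpleGraph.fromRel fun P Q =>
    ∃ x : reducedWords w,
      P = Sum.inl (Quotient.mk (braidSetoid w) x) ∧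
      Q = Sum.inr (Quotient.mk (commutationSetoid w) x)

/-- `w` is circuit-free if `Γ(w)` contains no circuit. -/
def CircuitFree {n : ℕ} (w : Equiv.Perm (Fin (n + 1))) : Prop :=
  (classGraph w).IsAcyclic

/-- `w` attains the lower bound: `|R(w)| = |B(w)| + |C(w)| - 1`, as an equation between integers. -/
def AttainsLowerBound {n : ℕ} (w : Equiv.Perm (Fin (n + 1))) : Prop :=
  (Nat.card (reducedWords w) : ℤ) =
    (Nat.card (BraidClasses w) : ℤ) + (Nat.card (CommutationClasses w) : ℤ) - 1

/-- The letters of a word as integers in `{1, …, n}`. -/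
def letters {n : ℕ} (x : List (Fin n)) : List ℤ :=
  x.map fun a => ((a : ℕ) : ℤ) + 1

/-- Complementation of a word: each letter `i ∈ {1, …, n}` is replaced by `n + 1 - i`. -/
def complement {n : ℕ} (x : List (Fin n)) : List (Fin n) :=
  x.map Fin.rev

/-- The increasing run `a (a+1) ⋯ (a+t)`. -/
def increasingRun (a : ℤ) (t : ℕ) : List ℤ :=
  (List.range (t + 1)).map fun k => a + (k : ℤ)

/-- The decreasing run `a (a-1) ⋯ (a-t)`. -/
def decreasingRun (a : ℤ) (t : ℕ) : List ℤ :=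
  (List.range (t + 1)).map fun k => a - (k : ℤ)

/-- The three conditions on the pair of words `u`, `v` surrounding the factor `i (i+1) i`. -/
def SpecialPair (i : ℤ) (u v : List ℤ) : Prop :=
  (u = [] ∧ (v = [i - 1, i] ∨ ∃ t : ℕ, v = decreasingRun (i - 1) t)) ∨
  (u = [i - 1] ∧ v = [i - 1]) ∨
  (∃ t t' : ℕ, u = increasingRun (i - 1 - (t : ℤ)) t ∧ v = increasingRun (i + 2) t')

/-- The word has the form `u i (i+1) i v` for a special pair `u`, `v`. -/
def SpecialWord {n : ℕ} (x : List (Fin n)) : Prop :=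
  ∃ (i : ℤ) (u v : List ℤ), letters x = u ++ [i, i + 1, i] ++ v ∧ SpecialPair i u v

/-- The word has, up to reversal, complementation and reverse complementation, the form
`u i (i+1) i v` for a special pair `u`, `v`. -/
def SpecialWordUpToSymmetry {n : ℕ} (x : List (Fin n)) : Prop :=
  SpecialWord x ∨ SpecialWord x.reverse ∨ SpecialWord (complement x) ∨
    SpecialWord (complement x).reverse

end ReducedWords

namespace ReducedWords

/-! A braid class and a commutation class share at most one word. A word orders the reflections it
produces. A commutation move transposes two commuting reflections, and a braid move reverses three
pairwise noncommuting ones. So the relative order of a commuting pair is constant on braid classes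
and that of a noncommuting pair on commutation classes. Two words in the same braid class and the
same commutation class therefore have equal reflection lists and coincide
(`eq_of_commutationSetoid_of_braidSetoid`).

Hence the edges of Γ(w) correspond to the reduced words, and Matsumoto's theorem makes Γ(w)
connected. A connected finite graph is acyclic exactly when it has one edge fewer than vertices,
which is the first equivalence (`circuitFree_iff_attainsLowerBound`).

Each listed condition is sufficient because at most one braid class, or at most one commutation
class, then has more than one word. The other classes being singletons, counting gives equality
(`card_add_one_le_of_fibre`). For the special words, an explicit move-closed set containing the word
displays the single nontrivial class (`SpecialPair.tame`).

For necessity, suppose both numbers of classes differ from 1. Then some word x admits both a braid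
move and a commutation move. In a forest the edge of x is a bridge, so no chain of moves avoiding x
joins its braid neighbour to its commutation neighbour (`CircuitFree.not_reflTransGen`). This rules
out disjoint moves, braids beside a letter commuting with both their letters, and most factors that
are longest words on four letters. What survives grows letter by letter into a special word
(`CircuitFreeSet.exists_special_of_factor`). -/

/-! ### Relations between simple reflections. -/

theorem simpleReflection_mul_self {n : ℕ} (a : Fin n) :
    simpleReflection a * simpleReflection a = 1 :=
  Equiv.swap_mul_self _ _

theorem simpleReflection_inv {n : ℕ} (a : Fin n) :
    (simpleReflection a)⁻¹ = simpleReflection a :=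
  Equiv.swap_inv _ _

theorem simpleReflection_mul_cancel_left {n : ℕ} (a : Fin n) (w : Equiv.Perm (Fin (n + 1))) :
    simpleReflection a * (simpleReflection a * w) = w := by
  rw [← mul_assoc, simpleReflection_mul_self, one_mul]

theorem simpleReflection_apply_castSucc {n : ℕ} (a : Fin n) :
    simpleReflection a a.castSucc = a.succ := Equiv.swap_apply_left _ _

theorem simpleReflection_apply_succ {n : ℕ} (a : Fin n) :
    simpleReflection a a.succ = a.castSucc := Equiv.swap_apply_right _ _

theorem simpleReflection_apply_of_ne {n : ℕ} {a : Fin n} {k : Fin (n + 1)}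
    (h₁ : k ≠ a.castSucc) (h₂ : k ≠ a.succ) : simpleReflection a k = k :=
  Equiv.swap_apply_of_ne_of_ne h₁ h₂

theorem simpleReflection_commute {n : ℕ} {a b : Fin n}
    (h : (a : ℕ) + 1 < b ∨ (b : ℕ) + 1 < a) :
    simpleReflection a * simpleReflection b = simpleReflection b * simpleReflection a := by
  refine (Equiv.Perm.disjoint_iff_eq_or_eq.2 fun k => ?_).commute
  by_cases hk : (k : ℕ) = a ∨ (k : ℕ) = a + 1
  · right
    apply simpleReflection_apply_of_ne <;> rw [Ne, Fin.ext_iff] <;>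
      simp only [Fin.val_castSucc, Fin.val_succ] <;> omega
  · left
    apply simpleReflection_apply_of_ne <;> rw [Ne, Fin.ext_iff] <;>
      simp only [Fin.val_castSucc, Fin.val_succ] <;> omega

theorem simpleReflection_braid_of_succ {n : ℕ} {a b : Fin n} (h : (a : ℕ) + 1 = b) :
    simpleReflection a * simpleReflection b * simpleReflection a =
      simpleReflection b * simpleReflection a * simpleReflection b := by
  have hb : b.castSucc = a.succ := Fin.ext h.symm
  have h₁ : a.castSucc ≠ a.succ := Fin.castSucc_lt_succ.ne
  have h₂ : a.castSucc ≠ b.succ := by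
    simp only [ne_eq, Fin.ext_iff, Fin.val_castSucc, Fin.val_succ]
    omega
  have h₃ : a.succ ≠ b.succ := by
    simp only [ne_eq, Fin.ext_iff, Fin.val_succ]
    omega
  rw [simpleReflection, simpleReflection, hb, Equiv.swap_mul_swap_mul_swap h₁ h₂,
    Equiv.swap_comm a.castSucc a.succ, Equiv.swap_comm a.succ b.succ,
    Equiv.swap_mul_swap_mul_swap h₃.symm h₂.symm, Equiv.swap_comm]

theorem simpleReflection_braid {n : ℕ} {a b : Fin n} (h : (a : ℕ) + 1 = b ∨ (b : ℕ) + 1 = a) :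
    simpleReflection a * simpleReflection b * simpleReflection a =
      simpleReflection b * simpleReflection a * simpleReflection b :=
  h.elim simpleReflection_braid_of_succ fun h => (simpleReflection_braid_of_succ h).symm

theorem simpleReflection_injective {n : ℕ} :
    Function.Injective (simpleReflection : Fin n → Equiv.Perm (Fin (n + 1))) := by
  intro a b h
  have h₁ := congrArg (fun w : Equiv.Perm (Fin (n + 1)) => ((w a.castSucc : Fin (n + 1)) : ℕ)) h
  have h₂ := congrArg (fun w : Equiv.Perm (Fin (n + 1)) => ((w a.succ : Fin (n + 1)) : ℕ)) h
  simp only [simpleReflection, Equiv.swap_apply_def, Fin.ext_iff, Fin.val_castSucc,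
    Fin.val_succ] at h₁ h₂
  ext
  split_ifs at h₁ h₂ <;> simp only [Fin.val_castSucc, Fin.val_succ] at h₁ h₂ <;> omega

theorem wordProd_cons {n : ℕ} (a : Fin n) (x : List (Fin n)) :
    wordProd (a :: x) = simpleReflection a * wordProd x := by
  simp [wordProd]

theorem wordProd_append {n : ℕ} (x y : List (Fin n)) :
    wordProd (x ++ y) = wordProd x * wordProd y := by
  simp [wordProd]

/-! ### Length as number of inversions. -/

/-- The set of inversions of a permutation. -/
def inversions {n : ℕ} (v : Equiv.Perm (Fin (n + 1))) : Finset (Fin (n + 1) × Fin (n + 1)) :=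
  {p | p.1 < p.2 ∧ v p.2 < v p.1}

theorem mem_inversions {n : ℕ} {v : Equiv.Perm (Fin (n + 1))} {i j : Fin (n + 1)} :
    (i, j) ∈ inversions v ↔ i < j ∧ v j < v i := by
  simp [inversions]

/-- The number of inversions of the inverse permutation. -/
def invNumber {n : ℕ} (w : Equiv.Perm (Fin (n + 1))) : ℕ :=
  (inversions w⁻¹).card

theorem simpleReflection_lt {n : ℕ} (a : Fin n) {i j : Fin (n + 1)} (hij : i < j)
    (h : ¬ (i = a.castSucc ∧ j = a.succ)) : simpleReflection a i < simpleReflection a j := by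
  simp only [simpleReflection, Equiv.swap_apply_def, Fin.ext_iff, Fin.lt_def,
    Fin.val_castSucc, Fin.val_succ] at *
  split_ifs <;> simp_all <;> omega

/-- Relabelling positions by the reflection preserves the order of every pair except the adjacent
one it swaps, and that pair becomes the only new inversion. -/
theorem card_inversions_mul_simpleReflection {n : ℕ} (v : Equiv.Perm (Fin (n + 1))) (a : Fin n)
    (h : v a.castSucc < v a.succ) :
    (inversions (v * simpleReflection a)).card = (inversions v).card + 1 := by
  have hs : ∀ k, simpleReflection a (simpleReflection a k) = k := fun k => by
    rw [← Equiv.Perm.mul_apply, simpleReflection_mul_self, Equiv.Perm.one_apply]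
  have key : inversions (v * simpleReflection a) =
      insert (a.castSucc, a.succ) ((inversions v).map
        (Equiv.prodCongr (simpleReflection a) (simpleReflection a)).toEmbedding) := by
    ext ⟨i, j⟩
    simp only [mem_inversions, Finset.mem_insert, Finset.mem_map, Equiv.coe_toEmbedding,
      Equiv.prodCongr_apply, Prod.exists, Prod.map, Prod.mk.injEq, Equiv.Perm.mul_apply]
    constructor
    · rintro ⟨hij, hv⟩
      by_cases hc : i = a.castSucc ∧ j = a.succ
      · exact Or.inl hc
      · exact Or.inr ⟨_, _, ⟨simpleReflection_lt a hij hc, hv⟩, hs i, hs j⟩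
    · rintro (⟨rfl, rfl⟩ | ⟨i, j, ⟨hij, hv⟩, rfl, rfl⟩)
      · refine ⟨Fin.castSucc_lt_succ, ?_⟩
        rwa [simpleReflection_apply_castSucc, simpleReflection_apply_succ]
      · rw [hs, hs]
        refine ⟨simpleReflection_lt a hij ?_, hv⟩
        rintro ⟨rfl, rfl⟩
        exact lt_asymm h hv
  rw [key, Finset.card_insert_of_notMem, Finset.card_map]
  simp only [mem_inversions, Finset.mem_map, Equiv.coe_toEmbedding, Equiv.prodCongr_apply,
    Prod.exists, Prod.map, Prod.mk.injEq]
  rintro ⟨i, j, ⟨hij, -⟩, hi, hj⟩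
  have hi' := congrArg (simpleReflection a) hi
  have hj' := congrArg (simpleReflection a) hj
  rw [hs, simpleReflection_apply_castSucc] at hi'
  rw [hs, simpleReflection_apply_succ] at hj'
  subst hi' hj'
  exact lt_asymm hij Fin.castSucc_lt_succ

/-- Prepending a letter multiplies on the left; the inverse in `invNumber` turns this into the right
multiplication handled above. -/
theorem invNumber_mul_of_lt {n : ℕ} {w : Equiv.Perm (Fin (n + 1))} {a : Fin n}
    (h : w⁻¹ a.castSucc < w⁻¹ a.succ) :
    invNumber (simpleReflection a * w) = invNumber w + 1 := by
  rw [invNumber, mul_inv_rev, simpleReflection_inv, card_inversions_mul_simpleReflection _ _ h,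
    invNumber]

theorem invNumber_mul_of_gt {n : ℕ} {w : Equiv.Perm (Fin (n + 1))} {a : Fin n}
    (h : w⁻¹ a.succ < w⁻¹ a.castSucc) :
    invNumber (simpleReflection a * w) + 1 = invNumber w := by
  rw [← invNumber_mul_of_lt (w := simpleReflection a * w) (a := a),
    simpleReflection_mul_cancel_left]
  simpa [mul_inv_rev, simpleReflection_inv, Equiv.Perm.mul_apply,
    simpleReflection_apply_castSucc, simpleReflection_apply_succ] using h

theorem inv_apply_lt_or_gt {n : ℕ} (w : Equiv.Perm (Fin (n + 1))) (a : Fin n) :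
    w⁻¹ a.castSucc < w⁻¹ a.succ ∨ w⁻¹ a.succ < w⁻¹ a.castSucc :=
  lt_or_gt_of_ne fun h => (Fin.castSucc_lt_succ (i := a)).ne (w⁻¹.injective h)

theorem invNumber_one {n : ℕ} : invNumber (1 : Equiv.Perm (Fin (n + 1))) = 0 := by
  simp only [invNumber, inversions, Finset.card_eq_zero, Finset.filter_eq_empty_iff]
  rintro ⟨i, j⟩ - ⟨h₁, h₂⟩
  exact lt_asymm h₁ (by simpa using h₂)

theorem invNumber_wordProd_le {n : ℕ} (x : List (Fin n)) :
    invNumber (wordProd x) ≤ x.length := by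
  induction x with
  | nil => simp [wordProd, invNumber_one]
  | cons a x ih =>
    rw [wordProd_cons, List.length_cons]
    rcases inv_apply_lt_or_gt (wordProd x) a with h | h
    · have := invNumber_mul_of_lt h
      omega
    · have := invNumber_mul_of_gt h
      omega

/-- Without a descent the inverse is strictly increasing, and a finite chain has only the trivial
order automorphism. -/
theorem exists_descent {n : ℕ} {w : Equiv.Perm (Fin (n + 1))} (hw : w ≠ 1) :
    ∃ a : Fin n, w⁻¹ a.succ < w⁻¹ a.castSucc := by
  by_contra! h
  have hm : StrictMono (w⁻¹ : Equiv.Perm (Fin (n + 1))) := by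
    rw [Fin.strictMono_iff_lt_succ]
    intro a
    exact (inv_apply_lt_or_gt w a).resolve_right (not_lt.2 (h a))
  apply hw
  have h1 : hm.orderIsoOfSurjective _ w⁻¹.surjective = OrderIso.refl _ := Subsingleton.elim _ _
  rw [← inv_eq_one]
  ext k : 1
  exact congrArg (fun e : Fin (n + 1) ≃o Fin (n + 1) => e k) h1

theorem exists_word_length_eq {n : ℕ} (w : Equiv.Perm (Fin (n + 1))) :
    ∃ x : List (Fin n), wordProd x = w ∧ x.length = invNumber w := by
  induction hk : invNumber w using Nat.strong_induction_on generalizing w with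
  | _ k ih =>
    by_cases hw : w = 1
    · subst hw
      exact ⟨[], by simp [wordProd], by simp [← hk, invNumber_one]⟩
    · obtain ⟨a, ha⟩ := exists_descent hw
      have h1 := invNumber_mul_of_gt ha
      obtain ⟨x, hx, hl⟩ := ih _ (by omega) (simpleReflection a * w) rfl
      refine ⟨a :: x, ?_, ?_⟩
      · rw [wordProd_cons, hx, simpleReflection_mul_cancel_left]
      · rw [List.length_cons]
        omega

theorem mem_reducedWords_iff {n : ℕ} {w : Equiv.Perm (Fin (n + 1))} {x : List (Fin n)} :
    x ∈ reducedWords w ↔ wordProd x = w ∧ x.length = invNumber w := by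
  constructor
  · rintro ⟨h, hmin⟩
    obtain ⟨y, hy, hl⟩ := exists_word_length_eq w
    exact ⟨h, le_antisymm (hl ▸ hmin y hy) (h ▸ invNumber_wordProd_le x)⟩
  · rintro ⟨h, hl⟩
    refine ⟨h, fun y hy => ?_⟩
    rw [hl, ← hy]
    exact invNumber_wordProd_le y

theorem reducedWords_nonempty {n : ℕ} (w : Equiv.Perm (Fin (n + 1))) :
    (reducedWords w).Nonempty := by
  obtain ⟨x, hx⟩ := exists_word_length_eq w
  exact ⟨x, mem_reducedWords_iff.2 hx⟩

theorem cons_mem_reducedWords {n : ℕ} {w : Equiv.Perm (Fin (n + 1))} {a : Fin n}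
    {x : List (Fin n)} (ha : w⁻¹ a.succ < w⁻¹ a.castSucc)
    (hx : x ∈ reducedWords (simpleReflection a * w)) : a :: x ∈ reducedWords w := by
  rw [mem_reducedWords_iff] at hx ⊢
  have := invNumber_mul_of_gt ha
  refine ⟨?_, ?_⟩
  · rw [wordProd_cons, hx.1, simpleReflection_mul_cancel_left]
  · rw [List.length_cons]
    omega

theorem of_cons_mem_reducedWords {n : ℕ} {w : Equiv.Perm (Fin (n + 1))} {a : Fin n}
    {x : List (Fin n)} (h : a :: x ∈ reducedWords w) :
    w⁻¹ a.succ < w⁻¹ a.castSucc ∧ x ∈ reducedWords (simpleReflection a * w) := by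
  rw [mem_reducedWords_iff] at h
  obtain ⟨h1, h2⟩ := h
  have hx : wordProd x = simpleReflection a * w := by
    rw [← h1, wordProd_cons, simpleReflection_mul_cancel_left]
  have hle := invNumber_wordProd_le x
  rw [hx] at hle
  rw [List.length_cons] at h2
  rcases inv_apply_lt_or_gt w a with h | h
  · have := invNumber_mul_of_lt h
    omega
  · have := invNumber_mul_of_gt h
    exact ⟨h, mem_reducedWords_iff.2 ⟨hx, by omega⟩⟩

/-! ### Moves and Matsumoto's theorem. -/

/-- A commutation move or a braid move. -/
def Move {n : ℕ} (x y : List (Fin n)) : Prop := CommutationMove x y ∨ BraidMove x y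

theorem CommutationMove.symm {n : ℕ} {x y : List (Fin n)} (h : CommutationMove x y) :
    CommutationMove y x := by
  obtain ⟨p, q, a, b, hab, rfl, rfl⟩ := h
  exact ⟨p, q, b, a, hab.symm, rfl, rfl⟩

theorem BraidMove.symm {n : ℕ} {x y : List (Fin n)} (h : BraidMove x y) : BraidMove y x := by
  obtain ⟨p, q, a, b, hab, rfl, rfl⟩ := h
  exact ⟨p, q, b, a, hab.symm, rfl, rfl⟩

theorem Move.symm {n : ℕ} {x y : List (Fin n)} (h : Move x y) : Move y x :=
  h.imp CommutationMove.symm BraidMove.symm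

theorem Move.cons {n : ℕ} {x y : List (Fin n)} (c : Fin n) (h : Move x y) :
    Move (c :: x) (c :: y) := by
  rcases h with ⟨p, q, a, b, hab, rfl, rfl⟩ | ⟨p, q, a, b, hab, rfl, rfl⟩
  · exact Or.inl ⟨c :: p, q, a, b, hab, rfl, rfl⟩
  · exact Or.inr ⟨c :: p, q, a, b, hab, rfl, rfl⟩

theorem Move.wordProd_eq {n : ℕ} {x y : List (Fin n)} (h : Move x y) :
    wordProd x = wordProd y := by
  rcases h with ⟨p, q, a, b, hab, rfl, rfl⟩ | ⟨p, q, a, b, hab, rfl, rfl⟩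
  · simp only [wordProd_append]
    congr 2
    simpa [wordProd] using simpleReflection_commute hab
  · simp only [wordProd_append]
    congr 2
    simpa [wordProd, mul_assoc] using simpleReflection_braid hab

theorem Move.length_eq {n : ℕ} {x y : List (Fin n)} (h : Move x y) : x.length = y.length := by
  rcases h with ⟨p, q, a, b, hab, rfl, rfl⟩ | ⟨p, q, a, b, hab, rfl, rfl⟩ <;> simp

theorem Move.mem_reducedWords {n : ℕ} {w : Equiv.Perm (Fin (n + 1))} {x y : List (Fin n)}
    (h : Move x y) (hx : x ∈ reducedWords w) : y ∈ reducedWords w := by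
  rw [mem_reducedWords_iff] at *
  rwa [← h.wordProd_eq, ← h.length_eq]

theorem reflTransGen_move_cons {n : ℕ} {x y : List (Fin n)} (c : Fin n)
    (h : Relation.ReflTransGen Move x y) : Relation.ReflTransGen Move (c :: x) (c :: y) :=
  h.lift (c :: ·) fun _ _ h => h.cons c

theorem inv_simpleReflection_mul_apply {n : ℕ} (w : Equiv.Perm (Fin (n + 1))) (a : Fin n)
    (k : Fin (n + 1)) : (simpleReflection a * w)⁻¹ k = w⁻¹ (simpleReflection a k) := by
  rw [mul_inv_rev, simpleReflection_inv, Equiv.Perm.mul_apply]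

/-- Two distinct descents are the first letters of two reduced words joined by a single move. -/
theorem exists_move_of_descents {n : ℕ} {w : Equiv.Perm (Fin (n + 1))} {a b : Fin n} (hab : a < b)
    (ha : w⁻¹ a.succ < w⁻¹ a.castSucc) (hb : w⁻¹ b.succ < w⁻¹ b.castSucc) :
    ∃ x y, a :: x ∈ reducedWords w ∧ b :: y ∈ reducedWords w ∧ Move (a :: x) (b :: y) := by
  have hlt : (a : ℕ) < b := hab
  rcases Nat.lt_or_ge ((a : ℕ) + 1) b with hc | hc
  · obtain ⟨z, hz⟩ := reducedWords_nonempty (simpleReflection b * (simpleReflection a * w))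
    have hb' : (simpleReflection a * w)⁻¹ b.succ < (simpleReflection a * w)⁻¹ b.castSucc := by
      rw [inv_simpleReflection_mul_apply, inv_simpleReflection_mul_apply,
        simpleReflection_apply_of_ne, simpleReflection_apply_of_ne]
      · exact hb
      all_goals simp [Fin.ext_iff]; omega
    have h1 : a :: b :: z ∈ reducedWords w :=
      cons_mem_reducedWords ha (cons_mem_reducedWords hb' hz)
    have hm : Move (a :: b :: z) (b :: a :: z) := Or.inl ⟨[], z, a, b, Or.inl hc, rfl, rfl⟩
    exact ⟨_, _, h1, hm.mem_reducedWords h1, hm⟩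
  -- Here b = a + 1. The two descents make the inverse decrease on three consecutive positions, so a
  -- b a can be stripped off as a reduced prefix.
  · have hba : b.castSucc = a.succ := by
      ext
      simp
      omega
    rw [hba] at hb
    have hne1 : a.castSucc ≠ b.succ := by simp [Fin.ext_iff]; omega
    have hne2 : a.castSucc ≠ a.succ := by simp [Fin.ext_iff]
    have hne3 : b.succ ≠ a.succ := by simp [Fin.ext_iff]; omega
    have e1 : simpleReflection a a.castSucc = a.succ := simpleReflection_apply_castSucc a
    have e2 : simpleReflection a a.succ = a.castSucc := simpleReflection_apply_succ a
    have e3 : simpleReflection a b.succ = b.succ :=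
      simpleReflection_apply_of_ne hne1.symm hne3
    have f1 : simpleReflection b a.succ = b.succ := hba ▸ simpleReflection_apply_castSucc b
    have f2 : simpleReflection b b.succ = a.succ := hba ▸ simpleReflection_apply_succ b
    have f3 : simpleReflection b a.castSucc = a.castSucc :=
      simpleReflection_apply_of_ne (hba ▸ hne2) hne1
    obtain ⟨z, hz⟩ := reducedWords_nonempty
      (simpleReflection a * (simpleReflection b * (simpleReflection a * w)))
    have hb' : (simpleReflection a * w)⁻¹ b.succ < (simpleReflection a * w)⁻¹ b.castSucc := by
      rw [inv_simpleReflection_mul_apply, inv_simpleReflection_mul_apply, hba, e2, e3]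
      exact hb.trans ha
    have ha' : (simpleReflection b * (simpleReflection a * w))⁻¹ a.succ <
        (simpleReflection b * (simpleReflection a * w))⁻¹ a.castSucc := by
      simp only [inv_simpleReflection_mul_apply, f1, f3, e1, e3]
      exact hb
    have h1 : a :: b :: a :: z ∈ reducedWords w :=
      cons_mem_reducedWords ha (cons_mem_reducedWords hb' (cons_mem_reducedWords ha' hz))
    have hm : Move (a :: b :: a :: z) (b :: a :: b :: z) :=
      Or.inr ⟨[], z, a, b, Or.inl (by omega), rfl, rfl⟩
    exact ⟨_, _, h1, hm.mem_reducedWords h1, hm⟩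

/-- Matsumoto's theorem: any two reduced words of a permutation are joined by commutation and braid
moves. -/
theorem reflTransGen_move_of_mem_reducedWords {n : ℕ} {w : Equiv.Perm (Fin (n + 1))}
    {x y : List (Fin n)} (hx : x ∈ reducedWords w) (hy : y ∈ reducedWords w) :
    Relation.ReflTransGen Move x y := by
  induction hk : x.length generalizing w x y with
  | zero =>
    have h := (mem_reducedWords_iff.1 hx).2.trans (mem_reducedWords_iff.1 hy).2.symm
    rw [List.eq_nil_of_length_eq_zero hk, List.eq_nil_of_length_eq_zero (h.symm.trans hk)]
  | succ k ih =>
    have hl := (mem_reducedWords_iff.1 hx).2.trans (mem_reducedWords_iff.1 hy).2.symm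
    obtain ⟨a, x, rfl⟩ := List.exists_cons_of_length_eq_add_one hk
    obtain ⟨b, y, rfl⟩ := List.exists_cons_of_length_eq_add_one (hl.symm.trans hk)
    simp only [List.length_cons, add_left_inj] at hk hl
    -- Words with a common first letter are joined by induction; different first letters are bridged
    -- by the move supplied by their two descents.
    have step : ∀ {c : Fin n} {u v : List (Fin n)}, c :: u ∈ reducedWords w →
        c :: v ∈ reducedWords w → u.length = k → Relation.ReflTransGen Move (c :: u) (c :: v) :=
      fun hu hv h => reflTransGen_move_cons _
        (ih (of_cons_mem_reducedWords hu).2 (of_cons_mem_reducedWords hv).2 h)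
    have ha := (of_cons_mem_reducedWords hx).1
    have hb := (of_cons_mem_reducedWords hy).1
    have swap : ∀ {x' y' : List (Fin n)}, a :: x' ∈ reducedWords w → b :: y' ∈ reducedWords w →
        Move (a :: x') (b :: y') → Relation.ReflTransGen Move (a :: x) (b :: y) := by
      intro x' y' hx' hy' hm
      refine (step hx hx' hk).trans (.head hm (step hy' hy ?_))
      have := (mem_reducedWords_iff.1 hy').2.trans (mem_reducedWords_iff.1 hy).2.symm
      simp only [List.length_cons, add_left_inj] at this
      omega
    rcases lt_trichotomy a b with hab | rfl | hab
    · obtain ⟨x', y', hx', hy', hm⟩ := exists_move_of_descents hab ha hb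
      exact swap hx' hy' hm
    · exact step hx hy hk
    · obtain ⟨y', x', hy', hx', hm⟩ := exists_move_of_descents hab hb ha
      exact swap hx' hy' hm.symm

/-! ### Reflection orders and intersections of classes. -/

/-- The list of reflections `s_{i₁} ⋯ s_{i_j} ⋯ s_{i₁}` attached to a word `i₁ i₂ ⋯ i_k`. -/
def reflectionList {n : ℕ} : List (Fin n) → List (Equiv.Perm (Fin (n + 1)))
  | [] => []
  | a :: x => simpleReflection a :: (reflectionList x).map (MulAut.conj (simpleReflection a))

theorem reflectionList_append {n : ℕ} (x y : List (Fin n)) :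
    reflectionList (x ++ y) =
      reflectionList x ++ (reflectionList y).map (MulAut.conj (wordProd x)) := by
  induction x with
  | nil => simp [reflectionList, wordProd]
  | cons a x ih =>
    simp only [List.cons_append, reflectionList, ih, wordProd_cons, map_mul, List.map_append,
      List.map_map]
    rfl

theorem reflectionList_injective {n : ℕ} :
    Function.Injective (reflectionList : List (Fin n) → List (Equiv.Perm (Fin (n + 1)))) := by
  intro x y h
  induction x generalizing y with
  | nil =>
    cases y with
    | nil => rfl
    | cons b y => simp [reflectionList] at h
  | cons a x ih =>
    cases y with
    | nil => simp [reflectionList] at h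
    | cons b y =>
      simp only [reflectionList, List.cons.injEq] at h
      obtain ⟨h₁, h₂⟩ := h
      obtain rfl := simpleReflection_injective h₁
      rw [ih (List.map_injective_iff.2 (MulAut.conj (simpleReflection a)).injective h₂)]

/-- A list is determined by its restrictions to the pairs of its elements. -/
theorem list_eq_of_filter_pair_eq {α : Type*} [DecidableEq α] {l l' : List α}
    (h : ∀ t t', l.filter (fun s => s = t ∨ s = t') = l'.filter (fun s => s = t ∨ s = t')) :
    l = l' := by
  induction l generalizing l' with
  | nil =>
    cases l' with
    | nil => rfl
    | cons b l' => simpa using h b b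
  | cons a l ih =>
    cases l' with
    | nil => simpa using h a a
    | cons b l' =>
      -- Restricted to the pair of the two heads, each list still starts with its own head.
      have hab : a = b := by
        have := h a b
        simp only [List.filter_cons, true_or, or_true, decide_true, if_true,
          List.cons.injEq] at this
        exact this.1
      subst hab
      rw [ih fun t t' => ?_]
      have := h t t'
      simp only [List.filter_cons] at this
      split_ifs at this
      · exact (List.cons.inj this).2
      · exact this

theorem commute_of_mem_pair {G : Type*} [Group G] {t t' u v : G} (huv : u ≠ v)
    (hu : u = t ∨ u = t') (hv : v = t ∨ v = t') : Commute u v ↔ Commute t t' := by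
  rcases hu with rfl | rfl <;> rcases hv with rfl | rfl
  · exact absurd rfl huv
  · rfl
  · exact ⟨Commute.symm, Commute.symm⟩
  · exact absurd rfl huv

/-- Only two adjacent, commuting reflections trade places, so at most one member of the noncommuting
pair is affected. -/
theorem CommutationMove.filter_reflectionList_eq {n : ℕ} {x y : List (Fin n)}
    (h : CommutationMove x y) {t t' : Equiv.Perm (Fin (n + 1))} (ht : ¬ Commute t t') :
    (reflectionList x).filter (fun s => s = t ∨ s = t') =
      (reflectionList y).filter (fun s => s = t ∨ s = t') := by
  obtain ⟨p, q, a, b, hab, rfl, rfl⟩ := h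
  have hc := simpleReflection_commute hab
  have h₁ : wordProd [a, b] = wordProd [b, a] := by simpa [wordProd] using hc
  have h₂ : reflectionList [a, b] = [simpleReflection a, simpleReflection b] := by
    simp [reflectionList, hc]
  have h₃ : reflectionList [b, a] = [simpleReflection b, simpleReflection a] := by
    simp [reflectionList, ← hc]
  simp only [reflectionList_append, wordProd_append, h₁, h₂, h₃, List.filter_append]
  congr 2
  have hc' : Commute (MulAut.conj (wordProd p) (simpleReflection a))
      (MulAut.conj (wordProd p) (simpleReflection b)) := Commute.map hc (MulAut.conj (wordProd p))
  simp only [List.map_cons, List.map_nil]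
  generalize MulAut.conj (wordProd p) (simpleReflection a) = u at *
  generalize MulAut.conj (wordProd p) (simpleReflection b) = v at *
  by_cases hu : u = t ∨ u = t' <;> by_cases hv : v = t ∨ v = t' <;>
    simp only [List.filter_cons, hu, hv, decide_true, decide_false, if_true, List.filter_nil]
  · by_cases huv : u = v
    · rw [huv]
    · exact absurd ((commute_of_mem_pair huv hu hv).1 hc') ht
  all_goals simp

theorem not_commute_simpleReflection {n : ℕ} {a b : Fin n}
    (h : (a : ℕ) + 1 = b ∨ (b : ℕ) + 1 = a) :
    ¬ Commute (simpleReflection a) (simpleReflection b) := by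
  intro hc
  have hb := simpleReflection_braid h
  rw [hc.eq, mul_assoc, simpleReflection_mul_self, mul_one, ← hc.eq, mul_assoc,
    simpleReflection_mul_self, mul_one] at hb
  obtain rfl := simpleReflection_injective hb
  omega

/-- The move reverses three consecutive reflections that pairwise fail to commute, so at most one of
them survives the restriction to a commuting pair. -/
theorem BraidMove.filter_reflectionList_eq {n : ℕ} {x y : List (Fin n)}
    (h : BraidMove x y) {t t' : Equiv.Perm (Fin (n + 1))} (ht : Commute t t') :
    (reflectionList x).filter (fun s => s = t ∨ s = t') =
      (reflectionList y).filter (fun s => s = t ∨ s = t') := by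
  obtain ⟨p, q, a, b, hab, rfl, rfl⟩ := h
  have hb := simpleReflection_braid hab
  have h₁ : wordProd [a, b, a] = wordProd [b, a, b] := by simpa [wordProd, mul_assoc] using hb
  have key : ∀ {a b : Fin n}, ((a : ℕ) + 1 = b ∨ (b : ℕ) + 1 = a) →
      reflectionList [a, b, a] = [simpleReflection a,
        simpleReflection a * simpleReflection b * simpleReflection a, simpleReflection b] := by
    intro a b hab
    have hb := simpleReflection_braid hab
    simp only [reflectionList, List.map_cons, List.map_nil, MulAut.conj_apply,
      simpleReflection_inv, mul_assoc, List.cons.injEq, and_true, true_and] at hb ⊢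
    rw [hb, simpleReflection_mul_cancel_left, simpleReflection_mul_cancel_left]
  have hm := not_commute_simpleReflection hab
  simp only [reflectionList_append, wordProd_append, h₁, key hab, key hab.symm,
    List.filter_append]
  congr 2
  rw [← hb]
  have h₁₂ : ¬ Commute (simpleReflection a)
      (simpleReflection a * simpleReflection b * simpleReflection a) := by
    intro hc
    apply hm
    have := hc.eq
    simp only [mul_assoc, simpleReflection_mul_cancel_left, simpleReflection_mul_self,
      mul_one] at this
    exact this.symm
  have h₂₃ : ¬ Commute (simpleReflection a * simpleReflection b * simpleReflection a)
      (simpleReflection b) := by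
    intro hc
    apply hm
    have := hc.eq
    rw [hb] at this
    simp only [mul_assoc, simpleReflection_mul_cancel_left, simpleReflection_mul_self,
      mul_one] at this
    exact this.symm
  have hcc : ∀ {u v : Equiv.Perm (Fin (n + 1))}, ¬ Commute u v →
      ¬ Commute (MulAut.conj (wordProd p) u) (MulAut.conj (wordProd p) v) :=
    fun h hc => h ((commute_map_iff (MulAut.conj (wordProd p)).injective).1 hc)
  have k₁ := hcc hm
  have k₂ := hcc h₁₂
  have k₃ := hcc h₂₃
  simp only [List.map_cons, List.map_nil]
  generalize MulAut.conj (wordProd p) (simpleReflection a) = u at *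
  generalize MulAut.conj (wordProd p) (simpleReflection b) = v at *
  generalize MulAut.conj (wordProd p) (simpleReflection a * simpleReflection b *
    simpleReflection a) = r at *
  have hne : ∀ {u v : Equiv.Perm (Fin (n + 1))}, ¬ Commute u v →
      ¬ ((u = t ∨ u = t') ∧ (v = t ∨ v = t')) := by
    rintro u v huv ⟨hu, hv⟩
    refine huv ((commute_of_mem_pair ?_ hu hv).2 ht)
    rintro rfl
    exact huv rfl
  have k₁ := hne k₁
  have k₂ := hne k₂
  have k₃ := hne k₃
  by_cases hu : u = t ∨ u = t' <;> by_cases hv : v = t ∨ v = t' <;>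
    by_cases hr : r = t ∨ r = t' <;> simp_all

/-- A braid class and a commutation class have at most one word in common. -/
theorem eq_of_commutationSetoid_of_braidSetoid {n : ℕ} {w : Equiv.Perm (Fin (n + 1))}
    {x y : reducedWords w} (hC : commutationSetoid w x y) (hB : braidSetoid w x y) : x = y := by
  apply Subtype.ext
  apply reflectionList_injective
  apply list_eq_of_filter_pair_eq
  intro t t'
  by_cases ht : Commute t t'
  · clear hC
    induction hB with
    | rel x y h => exact h.filter_reflectionList_eq ht
    | refl x => rfl
    | symm x y _ ih => exact ih.symm
    | trans x y z _ _ ih₁ ih₂ => exact ih₁.trans ih₂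
  · clear hB
    induction hC with
    | rel x y h => exact h.filter_reflectionList_eq ht
    | refl x => rfl
    | symm x y _ ih => exact ih.symm
    | trans x y z _ _ ih₁ ih₂ => exact ih₁.trans ih₂

/-! ### The class graph: edges, connectedness and the bound. -/

instance {n : ℕ} (w : Equiv.Perm (Fin (n + 1))) : Finite (reducedWords w) :=
  (finite_reducedWords w).to_subtype

instance {n : ℕ} (w : Equiv.Perm (Fin (n + 1))) : Nonempty (reducedWords w) :=
  (reducedWords_nonempty w).to_subtype

instance {n : ℕ} (w : Equiv.Perm (Fin (n + 1))) : Finite (BraidClasses w) := Quotient.finite _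

instance {n : ℕ} (w : Equiv.Perm (Fin (n + 1))) : Finite (CommutationClasses w) :=
  Quotient.finite _

/-- The braid class of a reduced word. -/
def braidClass {n : ℕ} {w : Equiv.Perm (Fin (n + 1))} (x : reducedWords w) : BraidClasses w :=
  Quotient.mk (braidSetoid w) x

/-- The commutation class of a reduced word. -/
def commutationClass {n : ℕ} {w : Equiv.Perm (Fin (n + 1))} (x : reducedWords w) :
    CommutationClasses w :=
  Quotient.mk (commutationSetoid w) x

theorem braidClass_eq_iff {n : ℕ} {w : Equiv.Perm (Fin (n + 1))} {x y : reducedWords w} :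
    braidClass x = braidClass y ↔ braidSetoid w x y := Quotient.eq

theorem commutationClass_eq_iff {n : ℕ} {w : Equiv.Perm (Fin (n + 1))} {x y : reducedWords w} :
    commutationClass x = commutationClass y ↔ commutationSetoid w x y := Quotient.eq

theorem eq_of_classes_eq {n : ℕ} {w : Equiv.Perm (Fin (n + 1))} {x y : reducedWords w}
    (hB : braidClass x = braidClass y) (hC : commutationClass x = commutationClass y) : x = y :=
  eq_of_commutationSetoid_of_braidSetoid (commutationClass_eq_iff.1 hC) (braidClass_eq_iff.1 hB)

theorem braidClass_eq_of_braidMove {n : ℕ} {w : Equiv.Perm (Fin (n + 1))} {x y : reducedWords w}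
    (h : BraidMove x.1 y.1) : braidClass x = braidClass y :=
  braidClass_eq_iff.2 (.rel _ _ h)

theorem commutationClass_eq_of_commutationMove {n : ℕ} {w : Equiv.Perm (Fin (n + 1))}
    {x y : reducedWords w} (h : CommutationMove x.1 y.1) :
    commutationClass x = commutationClass y :=
  commutationClass_eq_iff.2 (.rel _ _ h)

theorem classGraph_adj {n : ℕ} {w : Equiv.Perm (Fin (n + 1))} (x : reducedWords w) :
    (classGraph w).Adj (Sum.inl (braidClass x)) (Sum.inr (commutationClass x)) := by
  rw [classGraph, SimpleGraph.fromRel_adj]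
  exact ⟨Sum.inl_ne_inr, Or.inl ⟨x, rfl, rfl⟩⟩

/-- The edge of `Γ(w)` given by a reduced word. -/
def wordEdge {n : ℕ} {w : Equiv.Perm (Fin (n + 1))} (x : reducedWords w) :
    Sym2 (BraidClasses w ⊕ CommutationClasses w) :=
  s(Sum.inl (braidClass x), Sum.inr (commutationClass x))

theorem wordEdge_injective {n : ℕ} {w : Equiv.Perm (Fin (n + 1))} :
    Function.Injective (wordEdge : reducedWords w → _) := by
  intro x y h
  simp only [wordEdge, Sym2.eq_iff, Sum.inl.injEq, Sum.inr.injEq, reduceCtorEq, and_false,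
    or_false] at h
  exact eq_of_classes_eq h.1 h.2

theorem edgeSet_classGraph {n : ℕ} (w : Equiv.Perm (Fin (n + 1))) :
    (classGraph w).edgeSet = Set.range wordEdge := by
  ext e
  constructor
  · induction e with
    | h P Q =>
      rw [SimpleGraph.mem_edgeSet, classGraph, SimpleGraph.fromRel_adj]
      rintro ⟨-, ⟨x, rfl, rfl⟩ | ⟨x, rfl, rfl⟩⟩
      · exact ⟨x, rfl⟩
      · exact ⟨x, Sym2.eq_swap⟩
  · rintro ⟨x, rfl⟩
    exact classGraph_adj x

theorem card_edgeSet_classGraph {n : ℕ} (w : Equiv.Perm (Fin (n + 1))) :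
    Nat.card (classGraph w).edgeSet = Nat.card (reducedWords w) := by
  rw [edgeSet_classGraph]
  exact (Nat.card_congr (Equiv.ofInjective _ wordEdge_injective)).symm

theorem reachable_of_move {n : ℕ} {w : Equiv.Perm (Fin (n + 1))} {x y : reducedWords w}
    (h : Move x.1 y.1) :
    (classGraph w).Reachable (Sum.inl (braidClass x)) (Sum.inl (braidClass y)) := by
  rcases h with h | h
  · have hx := classGraph_adj x
    rw [commutationClass_eq_of_commutationMove h] at hx
    exact hx.reachable.trans (classGraph_adj y).symm.reachable
  · rw [braidClass_eq_of_braidMove h]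

/-- Any two reduced words are joined by moves through reduced words. -/
theorem reflTransGen_move {n : ℕ} {w : Equiv.Perm (Fin (n + 1))} (x y : reducedWords w) :
    Relation.ReflTransGen (fun x y : reducedWords w => Move x.1 y.1) x y := by
  obtain ⟨x, hx⟩ := x
  obtain ⟨y, hy⟩ := y
  have h := reflTransGen_move_of_mem_reducedWords hx hy
  induction h with
  | refl => exact .refl
  | tail _ hm ih =>
    have hz := hm.symm.mem_reducedWords hy
    exact (ih hz).tail hm

/-- Each move keeps one of the two classes of a word, so a chain of moves given by Matsumoto's
theorem traces a walk in the graph. -/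
theorem classGraph_connected {n : ℕ} (w : Equiv.Perm (Fin (n + 1))) :
    (classGraph w).Connected := by
  obtain ⟨x₀⟩ : Nonempty (reducedWords w) := inferInstance
  have hB : ∀ x, (classGraph w).Reachable (Sum.inl (braidClass x₀)) (Sum.inl (braidClass x)) := by
    intro x
    induction reflTransGen_move x₀ x with
    | refl => exact .rfl
    | tail _ hm ih => exact ih.trans (reachable_of_move hm)
  rw [SimpleGraph.connected_iff_exists_forall_reachable]
  refine ⟨Sum.inl (braidClass x₀), ?_⟩
  rintro (B | C)
  · induction B using Quotient.inductionOn with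
    | h x => exact hB x
  · induction C using Quotient.inductionOn with
    | h x => exact (hB x).trans (classGraph_adj x).reachable

theorem card_classes_le {n : ℕ} (w : Equiv.Perm (Fin (n + 1))) :
    Nat.card (BraidClasses w) + Nat.card (CommutationClasses w) ≤
      Nat.card (reducedWords w) + 1 := by
  rw [← Nat.card_sum, ← card_edgeSet_classGraph]
  exact (classGraph_connected w).card_vert_le_card_edgeSet_add_one

theorem circuitFree_iff_attainsLowerBound {n : ℕ} (w : Equiv.Perm (Fin (n + 1))) :
    CircuitFree w ↔ AttainsLowerBound w := by
  have h := SimpleGraph.isTree_iff_connected_and_card (G := classGraph w)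
  rw [card_edgeSet_classGraph, Nat.card_sum] at h
  have h' : CircuitFree w ↔ (classGraph w).IsTree :=
    ⟨fun h => ⟨classGraph_connected w, h⟩, fun h => h.2⟩
  rw [h', h, AttainsLowerBound, and_iff_right (classGraph_connected w)]
  omega

/-! ### Equality when only one class is nontrivial. -/

/-- If two functions are jointly injective and `g` is injective outside of a single fibre, then the
domain has fewer elements than the two codomains together. -/
theorem card_add_one_le_of_fibre {R B C : Type*} [Finite R] [Finite B] [Finite C]
    {f : R → B} {g : R → C} (hfg : ∀ x y, f x = f y → g x = g y → x = y) (c : C)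
    (hc : ∀ x y, g x = g y → x = y ∨ g x = c) :
    Nat.card R + 1 ≤ Nat.card B + Nat.card C := by
  classical
  rw [← Nat.card_unique (α := Unit), ← Nat.card_sum, ← Nat.card_sum]
  -- On the exceptional fibre `f` is injective by `hfg`, elsewhere `g` is; the value `c` is then
  -- free to receive the extra point.
  let φ : R ⊕ Unit → B ⊕ C := fun s => match s with
    | .inl x => if g x = c then .inl (f x) else .inr (g x)
    | .inr _ => .inr c
  refine Nat.card_le_card_of_injective φ ?_
  rintro (x | u) (y | v) h
  · simp only [φ] at h
    split_ifs at h with h₁ h₂ h₂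
    · rw [hfg x y (Sum.inl.inj h) (h₁.trans h₂.symm)]
    · rw [(hc x y (Sum.inr.inj h)).resolve_right h₁]
  · simp only [φ] at h
    split_ifs at h with h₁
    exact absurd (Sum.inr.inj h) h₁
  · simp only [φ] at h
    split_ifs at h with h₁
    exact absurd (Sum.inr.inj h).symm h₁
  · rfl

theorem attainsLowerBound_of_card_le {n : ℕ} {w : Equiv.Perm (Fin (n + 1))}
    (h : Nat.card (reducedWords w) + 1 ≤
      Nat.card (BraidClasses w) + Nat.card (CommutationClasses w)) : AttainsLowerBound w := by
  have := card_classes_le w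
  rw [AttainsLowerBound]
  omega

theorem attainsLowerBound_of_braidClass {n : ℕ} {w : Equiv.Perm (Fin (n + 1))}
    (B : BraidClasses w)
    (h : ∀ x y : reducedWords w, braidClass x = braidClass y → x = y ∨ braidClass x = B) :
    AttainsLowerBound w := by
  apply attainsLowerBound_of_card_le
  rw [add_comm (Nat.card (BraidClasses w))]
  exact card_add_one_le_of_fibre (fun x y h₁ h₂ => eq_of_classes_eq h₂ h₁) B h

theorem attainsLowerBound_of_commutationClass {n : ℕ} {w : Equiv.Perm (Fin (n + 1))}
    (C : CommutationClasses w) (h : ∀ x y : reducedWords w,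
      commutationClass x = commutationClass y → x = y ∨ commutationClass x = C) :
    AttainsLowerBound w :=
  attainsLowerBound_of_card_le
    (card_add_one_le_of_fibre (fun _ _ h₁ h₂ => eq_of_classes_eq h₁ h₂) C h)

theorem attainsLowerBound_of_card_braidClasses {n : ℕ} {w : Equiv.Perm (Fin (n + 1))}
    (h : Nat.card (BraidClasses w) = 1) : AttainsLowerBound w := by
  obtain ⟨_, ⟨B⟩⟩ := Nat.card_eq_one_iff_unique.1 h
  exact attainsLowerBound_of_braidClass B fun _ _ _ => Or.inr (Subsingleton.elim _ _)

theorem attainsLowerBound_of_card_commutationClasses {n : ℕ} {w : Equiv.Perm (Fin (n + 1))}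
    (h : Nat.card (CommutationClasses w) = 1) : AttainsLowerBound w := by
  obtain ⟨_, ⟨C⟩⟩ := Nat.card_eq_one_iff_unique.1 h
  exact attainsLowerBound_of_commutationClass C fun _ _ _ => Or.inr (Subsingleton.elim _ _)

/-! ### Circuit-free permutations and bridges. -/

/-- In a circuit-free permutation, a word `x` separates its neighbours under braid moves from its
neighbours under commutation moves. -/
theorem CircuitFree.not_reflTransGen {n : ℕ} {w : Equiv.Perm (Fin (n + 1))} (hw : CircuitFree w)
    {x y z : List (Fin n)} (hx : x ∈ reducedWords w) (hy : BraidMove x y)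
    (hz : CommutationMove x z) :
    ¬ Relation.ReflTransGen (fun u v => Move u v ∧ v ≠ x) y z := by
  intro hyz
  have hne : y ≠ x := by
    rintro rfl
    obtain ⟨p, q, a, b, hab, h₁, h₂⟩ := hy
    rw [h₁] at h₂
    simp only [List.append_assoc, List.append_cancel_left_eq, List.cons_append, List.cons.injEq]
      at h₂
    obtain ⟨rfl, -⟩ := h₂
    omega
  have hyR : y ∈ reducedWords w := Move.mem_reducedWords (Or.inr hy) hx
  have hzR : z ∈ reducedWords w := Move.mem_reducedWords (Or.inl hz) hx
  let X : reducedWords w := ⟨x, hx⟩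
  let Y : reducedWords w := ⟨y, hyR⟩
  have hbr := (SimpleGraph.isAcyclic_iff_forall_isBridge.1 hw)
    ((classGraph w).mem_edgeSet.2 (classGraph_adj X))
  rw [SimpleGraph.isBridge_iff] at hbr
  have hadj : ∀ u : reducedWords w, u ≠ X → ((classGraph w).deleteEdges {wordEdge X}).Adj
      (Sum.inl (braidClass u)) (Sum.inr (commutationClass u)) := by
    intro u hu
    rw [SimpleGraph.deleteEdges_adj]
    exact ⟨classGraph_adj u, fun h => hu (wordEdge_injective h)⟩
  -- Only the edge of `x` is deleted, so a chain of words avoiding `x` still gives a walk. It would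
  -- reconnect the braid class of `x`, shared with `y`, to its commutation class, shared with `z`.
  have key : ∀ (u : List (Fin n)) (hu : u ∈ reducedWords w),
      Relation.ReflTransGen (fun u v => Move u v ∧ v ≠ x) y u →
      u ≠ x ∧ ((classGraph w).deleteEdges {wordEdge X}).Reachable
        (Sum.inl (braidClass Y)) (Sum.inl (braidClass ⟨u, hu⟩)) := by
    intro u hu h
    induction h with
    | refl => exact ⟨hne, .rfl⟩
    | @tail u v _ hm ih =>
      obtain ⟨hux, hr⟩ := ih (hm.1.symm.mem_reducedWords hu)
      refine ⟨hm.2, hr.trans ?_⟩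
      have hU := hadj ⟨u, hm.1.symm.mem_reducedWords hu⟩ fun h => hux (congrArg Subtype.val h)
      have hV := hadj ⟨v, hu⟩ fun h => hm.2 (congrArg Subtype.val h)
      rcases hm.1 with h | h
      · rw [commutationClass_eq_of_commutationMove (y := ⟨v, hu⟩) h] at hU
        exact hU.reachable.trans hV.symm.reachable
      · rw [braidClass_eq_of_braidMove (y := ⟨v, hu⟩) h]
  obtain ⟨hzx, hr⟩ := key z hzR hyz
  apply hbr
  have hZ := hadj ⟨z, hzR⟩ fun h => hzx (congrArg Subtype.val h)
  rw [← commutationClass_eq_of_commutationMove (x := X) (y := ⟨z, hzR⟩) hz] at hZ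
  rw [← braidClass_eq_of_braidMove (x := X) (y := Y) hy] at hr
  exact hr.trans hZ.reachable

/-! ### Transfer to words of integers, where shifts and reflections are unrestricted. -/

/-- A commutation move on words of integers. -/
def IntCommutationMove (x y : List ℤ) : Prop :=
  ∃ (p q : List ℤ) (a b : ℤ), (a + 1 < b ∨ b + 1 < a) ∧
    x = p ++ [a, b] ++ q ∧ y = p ++ [b, a] ++ q

/-- A braid move on words of integers. -/
def IntBraidMove (x y : List ℤ) : Prop :=
  ∃ (p q : List ℤ) (a b : ℤ), (a + 1 = b ∨ b + 1 = a) ∧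
    x = p ++ [a, b, a] ++ q ∧ y = p ++ [b, a, b] ++ q

/-- A commutation move or a braid move on words of integers. -/
def IntMove (x y : List ℤ) : Prop := IntCommutationMove x y ∨ IntBraidMove x y

theorem IntCommutationMove.symm {x y : List ℤ} (h : IntCommutationMove x y) :
    IntCommutationMove y x := by
  obtain ⟨p, q, a, b, hab, rfl, rfl⟩ := h
  exact ⟨p, q, b, a, hab.symm, rfl, rfl⟩

theorem IntBraidMove.symm {x y : List ℤ} (h : IntBraidMove x y) : IntBraidMove y x := by
  obtain ⟨p, q, a, b, hab, rfl, rfl⟩ := h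
  exact ⟨p, q, b, a, hab.symm, rfl, rfl⟩

theorem letters_eq_map {n : ℕ} (x : List (Fin n)) :
    letters x = x.map fun a : Fin n => ((a : ℕ) : ℤ) + 1 := by
  induction x with
  | nil => rfl
  | cons a x ih => exact congrArg (((a : ℕ) + 1 : ℤ) :: ·) ih

theorem letters_injective {n : ℕ} : Function.Injective (letters : List (Fin n) → List ℤ) := by
  intro x y h
  rw [letters_eq_map, letters_eq_map] at h
  refine List.map_injective_iff.2 (fun a b h => ?_) h
  ext
  simpa using h

theorem CommutationMove.letters {n : ℕ} {x y : List (Fin n)} (h : CommutationMove x y) :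
    IntCommutationMove (letters x) (letters y) := by
  obtain ⟨p, q, a, b, hab, rfl, rfl⟩ := h
  refine ⟨ReducedWords.letters p, ReducedWords.letters q, (a : ℕ) + 1, (b : ℕ) + 1, by omega,
    ?_, ?_⟩ <;>
    simp [letters_eq_map]

theorem BraidMove.letters {n : ℕ} {x y : List (Fin n)} (h : BraidMove x y) :
    IntBraidMove (letters x) (letters y) := by
  obtain ⟨p, q, a, b, hab, rfl, rfl⟩ := h
  refine ⟨ReducedWords.letters p, ReducedWords.letters q, (a : ℕ) + 1, (b : ℕ) + 1, by omega,
    ?_, ?_⟩ <;>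
    simp [letters_eq_map]

theorem letters_eq_append {n : ℕ} {x : List (Fin n)} {p q : List ℤ} (h : letters x = p ++ q) :
    ∃ p' q', x = p' ++ q' ∧ letters p' = p ∧ letters q' = q := by
  obtain ⟨p', q', h₁, h₂, h₃⟩ := List.map_eq_append_iff.1 (letters_eq_map x ▸ h)
  exact ⟨p', q', h₁, (letters_eq_map p').trans h₂, (letters_eq_map q').trans h₃⟩

theorem letters_eq_cons {n : ℕ} {x : List (Fin n)} {a : ℤ} {q : List ℤ} (h : letters x = a :: q) :
    ∃ (a' : Fin n) (q' : List (Fin n)), x = a' :: q' ∧ ((a' : ℕ) : ℤ) + 1 = a ∧ letters q' = q := by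
  obtain ⟨a', q', h₁, h₂, h₃⟩ := List.map_eq_cons_iff.1 (letters_eq_map x ▸ h)
  exact ⟨a', q', h₁, h₂, (letters_eq_map q').trans h₃⟩

theorem exists_commutationMove_of_letters {n : ℕ} {x : List (Fin n)} {z : List ℤ}
    (h : IntCommutationMove (letters x) z) : ∃ y, letters y = z ∧ CommutationMove x y := by
  obtain ⟨p, q, a, b, hab, h, rfl⟩ := h
  rw [List.append_assoc] at h
  obtain ⟨p, r, rfl, rfl, h₁⟩ := letters_eq_append h
  obtain ⟨a, r, rfl, rfl, h₂⟩ := letters_eq_cons h₁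
  obtain ⟨b, q, rfl, rfl, rfl⟩ := letters_eq_cons h₂
  refine ⟨p ++ [b, a] ++ q, by simp [letters_eq_map], p, q, a, b, by omega, by simp, rfl⟩

theorem exists_braidMove_of_letters {n : ℕ} {x : List (Fin n)} {z : List ℤ}
    (h : IntBraidMove (letters x) z) : ∃ y, letters y = z ∧ BraidMove x y := by
  obtain ⟨p, q, a, b, hab, h, rfl⟩ := h
  rw [List.append_assoc] at h
  obtain ⟨p, r, rfl, rfl, h₁⟩ := letters_eq_append h
  obtain ⟨a, r, rfl, rfl, h₂⟩ := letters_eq_cons h₁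
  obtain ⟨b, r, rfl, rfl, h₃⟩ := letters_eq_cons h₂
  obtain ⟨a', q, rfl, ha, rfl⟩ := letters_eq_cons h₃
  obtain rfl : a' = a := by
    ext
    omega
  refine ⟨p ++ [b, a', b] ++ q, by simp [letters_eq_map], p, q, a', b, by omega, by simp, rfl⟩

theorem exists_move_of_letters {n : ℕ} {x : List (Fin n)} {z : List ℤ}
    (h : IntMove (letters x) z) : ∃ y, letters y = z ∧ Move x y := by
  rcases h with h | h
  · obtain ⟨y, hy, h⟩ := exists_commutationMove_of_letters h
    exact ⟨y, hy, Or.inl h⟩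
  · obtain ⟨y, hy, h⟩ := exists_braidMove_of_letters h
    exact ⟨y, hy, Or.inr h⟩

/-- The reduced words of a permutation as words of integers. -/
def intReducedWords {n : ℕ} (w : Equiv.Perm (Fin (n + 1))) : Set (List ℤ) :=
  letters '' reducedWords w

/-- A set of words which behaves like the set of reduced words of a circuit-free permutation. -/
structure CircuitFreeSet (S : Set (List ℤ)) : Prop where
  closed : ∀ {x y}, x ∈ S → IntMove x y → y ∈ S
  no_square : ∀ p a q, p ++ [a, a] ++ q ∉ S
  separates : ∀ {x y z}, x ∈ S → IntBraidMove x y → IntCommutationMove x z →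
    ¬ Relation.ReflTransGen (fun u v => IntMove u v ∧ v ≠ x) y z

theorem CircuitFree.circuitFreeSet {n : ℕ} {w : Equiv.Perm (Fin (n + 1))} (hw : CircuitFree w) :
    CircuitFreeSet (intReducedWords w) where
  closed := by
    rintro _ y ⟨x, hx, rfl⟩ h
    obtain ⟨y, rfl, hm⟩ := exists_move_of_letters h
    exact ⟨y, hm.mem_reducedWords hx, rfl⟩
  no_square := by
    rintro p a q ⟨x, hx, h⟩
    rw [List.append_assoc] at h
    obtain ⟨p, r, rfl, rfl, h₁⟩ := letters_eq_append h
    obtain ⟨a, r, rfl, rfl, h₂⟩ := letters_eq_cons h₁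
    obtain ⟨a', q, rfl, ha, rfl⟩ := letters_eq_cons h₂
    obtain rfl : a' = a := by
      ext
      omega
    -- Cancelling the square leaves a shorter word with the same product.
    have := hx.2 (p ++ q) (by
      rw [← hx.1, wordProd_append, wordProd_append, wordProd_cons, wordProd_cons,
        simpleReflection_mul_cancel_left])
    simp at this
  separates := by
    rintro _ y z ⟨x, hx, rfl⟩ hy hz h
    obtain ⟨y, rfl, hy'⟩ := exists_braidMove_of_letters hy
    obtain ⟨z, rfl, hz'⟩ := exists_commutationMove_of_letters hz
    have key : ∀ u, Relation.ReflTransGen (fun u v => IntMove u v ∧ v ≠ letters x) (letters y) u →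
        ∃ u', letters u' = u ∧ Relation.ReflTransGen (fun u v => Move u v ∧ v ≠ x) y u' := by
      intro u hu
      induction hu with
      | refl => exact ⟨y, rfl, .refl⟩
      | tail _ hm ih =>
        obtain ⟨u, rfl, hu⟩ := ih
        obtain ⟨v, rfl, hv⟩ := exists_move_of_letters hm.1
        exact ⟨v, rfl, hu.tail ⟨hv, fun h => hm.2 (congrArg _ h)⟩⟩
    obtain ⟨z', hz'', h⟩ := key _ h
    rw [letters_injective hz''] at h
    exact hw.not_reflTransGen hx hy' hz' h

/-! ### Move-closed sets with a single nontrivial class. -/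

/-- All words of the set that have a neighbour under `r` are joined by `r`. -/
def SingleClass (r : List ℤ → List ℤ → Prop) (A : Set (List ℤ)) : Prop :=
  ∀ ⦃x y x' y'⦄, x ∈ A → x' ∈ A → r x y → r x' y' → Relation.ReflTransGen r x x'

/-- The set is closed under moves. -/
def MoveClosed (A : Set (List ℤ)) : Prop := ∀ ⦃x y⦄, x ∈ A → IntMove x y → y ∈ A

/-- By Matsumoto's theorem one reduced word in the set drags in all the others. -/
theorem MoveClosed.intReducedWords_subset {n : ℕ} {w : Equiv.Perm (Fin (n + 1))}
    {A : Set (List ℤ)} (hA : MoveClosed A) {x : List ℤ} (hx : x ∈ intReducedWords w)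
    (hxA : x ∈ A) : intReducedWords w ⊆ A := by
  obtain ⟨x, hx, rfl⟩ := hx
  rintro _ ⟨y, hy, rfl⟩
  induction reflTransGen_move_of_mem_reducedWords hx hy with
  | refl => exact hxA
  | tail _ hm ih =>
    exact hA (ih (hm.symm.mem_reducedWords hy)) (hm.imp CommutationMove.letters BraidMove.letters)

/-- An element related to a different one has a neighbour. -/
theorem exists_rel_of_eqvGen {α : Type*} {r : α → α → Prop} (hr : ∀ x y, r x y → r y x) {x y : α}
    (h : Relation.EqvGen r x y) (hne : x ≠ y) : ∃ z, r x z := by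
  have key : (∃ z, r x z) ∧ (∃ z, r y z) ∨ x = y := by
    induction h with
    | rel x y h => exact Or.inl ⟨⟨y, h⟩, ⟨x, hr x y h⟩⟩
    | refl x => exact Or.inr rfl
    | symm x y _ ih => exact (ih (Ne.symm hne)).imp And.symm Eq.symm
    | trans x y z _ _ ih₁ ih₂ =>
      by_cases h₁ : x = y
      · subst h₁
        exact ih₂ hne
      · by_cases h₂ : y = z
        · subst h₂
          exact ih₁ hne
        · exact Or.inl ⟨((ih₁ h₁).resolve_right h₁).1, ((ih₂ h₂).resolve_right h₂).2⟩
  exact (key.resolve_right hne).1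

/-- A class with two words consists of words having a neighbour, so all such classes coincide with
one exceptional class. -/
theorem attainsLowerBound_of_singleClass_braid {n : ℕ} {w : Equiv.Perm (Fin (n + 1))}
    (h : SingleClass IntBraidMove (intReducedWords w)) : AttainsLowerBound w := by
  have hex : ∀ x y : reducedWords w, braidClass x = braidClass y → x ≠ y →
      ∃ z : reducedWords w, BraidMove x.1 z.1 := fun x y hxy hne =>
    exists_rel_of_eqvGen (fun x y h => h.symm) (braidClass_eq_iff.1 hxy) hne
  by_cases hB : ∃ x y : reducedWords w, braidClass x = braidClass y ∧ x ≠ y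
  · obtain ⟨x₀, y₀, h₀, hne₀⟩ := hB
    obtain ⟨z₀, hz₀⟩ := hex x₀ y₀ h₀ hne₀
    refine attainsLowerBound_of_braidClass (braidClass x₀) fun x y hxy =>
      or_iff_not_imp_left.2 fun hne => ?_
    obtain ⟨z, hz⟩ := hex x y hxy hne
    have hr := h ⟨x₀, x₀.2, rfl⟩ ⟨x, x.2, rfl⟩ hz₀.letters hz.letters
    have key : ∀ u, Relation.ReflTransGen IntBraidMove (letters x₀.1) u →
        ∃ u' : reducedWords w, letters u'.1 = u ∧ braidClass u' = braidClass x₀ := by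
      intro u hu
      induction hu with
      | refl => exact ⟨x₀, rfl, rfl⟩
      | tail _ hm ih =>
        obtain ⟨u, rfl, hu⟩ := ih
        obtain ⟨v, rfl, hv⟩ := exists_braidMove_of_letters hm
        exact ⟨⟨v, Move.mem_reducedWords (Or.inr hv) u.2⟩, rfl,
          (braidClass_eq_of_braidMove hv.symm).trans hu⟩
    obtain ⟨u, hu, hu'⟩ := key _ hr
    rw [← hu', Subtype.ext (letters_injective hu)]
  · push Not at hB
    obtain ⟨x₀⟩ : Nonempty (reducedWords w) := inferInstance
    exact attainsLowerBound_of_braidClass (braidClass x₀) fun x y hxy => Or.inl (hB x y hxy)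

theorem attainsLowerBound_of_singleClass_commutation {n : ℕ} {w : Equiv.Perm (Fin (n + 1))}
    (h : SingleClass IntCommutationMove (intReducedWords w)) : AttainsLowerBound w := by
  have hex : ∀ x y : reducedWords w, commutationClass x = commutationClass y → x ≠ y →
      ∃ z : reducedWords w, CommutationMove x.1 z.1 := fun x y hxy hne =>
    exists_rel_of_eqvGen (fun x y h => h.symm) (commutationClass_eq_iff.1 hxy) hne
  by_cases hB : ∃ x y : reducedWords w, commutationClass x = commutationClass y ∧ x ≠ y
  · obtain ⟨x₀, y₀, h₀, hne₀⟩ := hB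
    obtain ⟨z₀, hz₀⟩ := hex x₀ y₀ h₀ hne₀
    refine attainsLowerBound_of_commutationClass (commutationClass x₀) fun x y hxy =>
      or_iff_not_imp_left.2 fun hne => ?_
    obtain ⟨z, hz⟩ := hex x y hxy hne
    have hr := h ⟨x₀, x₀.2, rfl⟩ ⟨x, x.2, rfl⟩ hz₀.letters hz.letters
    have key : ∀ u, Relation.ReflTransGen IntCommutationMove (letters x₀.1) u →
        ∃ u' : reducedWords w, letters u'.1 = u ∧ commutationClass u' = commutationClass x₀ := by
      intro u hu
      induction hu with
      | refl => exact ⟨x₀, rfl, rfl⟩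
      | tail _ hm ih =>
        obtain ⟨u, rfl, hu⟩ := ih
        obtain ⟨v, rfl, hv⟩ := exists_commutationMove_of_letters hm
        exact ⟨⟨v, Move.mem_reducedWords (Or.inl hv) u.2⟩, rfl,
          (commutationClass_eq_of_commutationMove hv.symm).trans hu⟩
    obtain ⟨u, hu, hu'⟩ := key _ hr
    rw [← hu', Subtype.ext (letters_injective hu)]
  · push Not at hB
    obtain ⟨x₀⟩ : Nonempty (reducedWords w) := inferInstance
    exact attainsLowerBound_of_commutationClass (commutationClass x₀) fun x y hxy =>
      Or.inl (hB x y hxy)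

/-! ### Reversal and complementation as symmetries. -/

/-- Subtraction of all letters from `N`. -/
def reflectWord (N : ℤ) (x : List ℤ) : List ℤ := x.map fun a => N - a

/-- An involution of words that respects moves and squares. -/
structure WordSymmetry (f : List ℤ → List ℤ) : Prop where
  involutive : Function.Involutive f
  commutation : ∀ {x y}, IntCommutationMove x y → IntCommutationMove (f x) (f y)
  braid : ∀ {x y}, IntBraidMove x y → IntBraidMove (f x) (f y)
  square : ∀ p a q, ∃ p' a' q', f (p ++ [a, a] ++ q) = p' ++ [a', a'] ++ q'

theorem wordSymmetry_reverse : WordSymmetry List.reverse where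
  involutive := List.reverse_involutive
  commutation := by
    rintro _ _ ⟨p, q, a, b, hab, rfl, rfl⟩
    exact ⟨q.reverse, p.reverse, b, a, hab.symm, by simp, by simp⟩
  braid := by
    rintro _ _ ⟨p, q, a, b, hab, rfl, rfl⟩
    exact ⟨q.reverse, p.reverse, a, b, hab, by simp, by simp⟩
  square p a q := ⟨q.reverse, a, p.reverse, by simp⟩

theorem wordSymmetry_reflectWord (N : ℤ) : WordSymmetry (reflectWord N) where
  involutive x := by simp [reflectWord]
  commutation := by
    rintro _ _ ⟨p, q, a, b, hab, rfl, rfl⟩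
    exact ⟨reflectWord N p, reflectWord N q, N - a, N - b, by omega, by simp [reflectWord],
      by simp [reflectWord]⟩
  braid := by
    rintro _ _ ⟨p, q, a, b, hab, rfl, rfl⟩
    exact ⟨reflectWord N p, reflectWord N q, N - a, N - b, by omega, by simp [reflectWord],
      by simp [reflectWord]⟩
  square p a q := ⟨reflectWord N p, N - a, reflectWord N q, by simp [reflectWord]⟩

theorem WordSymmetry.move {f : List ℤ → List ℤ} (hf : WordSymmetry f) {x y : List ℤ}
    (h : IntMove x y) : IntMove (f x) (f y) :=
  h.imp hf.commutation hf.braid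

theorem CircuitFreeSet.preimage {S : Set (List ℤ)} (hS : CircuitFreeSet S)
    {f : List ℤ → List ℤ} (hf : WordSymmetry f) : CircuitFreeSet (f ⁻¹' S) where
  closed hx h := hS.closed hx (hf.move h)
  no_square p a q h := by
    obtain ⟨p', a', q', h'⟩ := hf.square p a q
    rw [Set.mem_preimage, h'] at h
    exact hS.no_square _ _ _ h
  separates hx hy hz h := hS.separates hx (hf.braid hy) (hf.commutation hz)
    (h.lift f fun _ _ h => ⟨hf.move h.1, fun h' => h.2 (hf.involutive.injective h')⟩)

theorem MoveClosed.preimage {A : Set (List ℤ)} (hA : MoveClosed A) {f : List ℤ → List ℤ}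
    (hf : WordSymmetry f) : MoveClosed (f ⁻¹' A) :=
  fun _ _ hx h => hA hx (hf.move h)

theorem SingleClass.preimage {r : List ℤ → List ℤ → Prop} {A : Set (List ℤ)}
    (hA : SingleClass r A) {f : List ℤ → List ℤ} (hf : Function.Involutive f)
    (hr : ∀ {x y}, r x y → r (f x) (f y)) : SingleClass r (f ⁻¹' A) := by
  intro x y x' y' hx hx' h h'
  have := (hA hx hx' (hr h) (hr h')).lift f fun _ _ h => hr h
  rwa [Function.onFun, hf, hf] at this

/-- The word lies in a set of words, closed under moves, with at most one nontrivial braid class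
or at most one nontrivial commutation class. -/
def Tame (x : List ℤ) : Prop :=
  ∃ A : Set (List ℤ), MoveClosed A ∧ x ∈ A ∧
    (SingleClass IntBraidMove A ∨ SingleClass IntCommutationMove A)

theorem Tame.of_symmetry {f : List ℤ → List ℤ} (hf : WordSymmetry f) {x : List ℤ}
    (h : Tame (f x)) : Tame x := by
  obtain ⟨A, hA, hx, h⟩ := h
  exact ⟨f ⁻¹' A, hA.preimage hf, hx, h.imp (fun h => h.preimage hf.involutive hf.braid)
    fun h => h.preimage hf.involutive hf.commutation⟩

theorem Tame.of_move {x y : List ℤ} (hxy : IntMove x y) (h : Tame x) : Tame y := by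
  obtain ⟨A, hA, hx, h⟩ := h
  exact ⟨A, hA, hA hx hxy, h⟩

theorem SingleClass.mono {r : List ℤ → List ℤ → Prop} {A A' : Set (List ℤ)}
    (hA : SingleClass r A) (h : A' ⊆ A) : SingleClass r A' :=
  fun _ _ _ _ hx hx' => hA (h hx) (h hx')

/-- The witnessing set may be larger than the set of reduced words, since having a single nontrivial
class passes to subsets. -/
theorem Tame.attainsLowerBound {n : ℕ} {w : Equiv.Perm (Fin (n + 1))} {x : List ℤ} (h : Tame x)
    (hx : x ∈ intReducedWords w) : AttainsLowerBound w := by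
  obtain ⟨A, hA, hxA, h⟩ := h
  have hsub := hA.intReducedWords_subset hx hxA
  rcases h with h | h
  · exact attainsLowerBound_of_singleClass_braid (h.mono hsub)
  · exact attainsLowerBound_of_singleClass_commutation (h.mono hsub)

/-! ### The two finite families, by computation. -/

/-- All words obtained by a commutation move. -/
def commutationNeighbors : List ℤ → List (List ℤ)
  | a :: b :: x => (if a + 1 < b ∨ b + 1 < a then [b :: a :: x] else []) ++
      (commutationNeighbors (b :: x)).map (a :: ·)
  | _ => []

/-- All words obtained by a braid move. -/
def braidNeighbors : List ℤ → List (List ℤ)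
  | a :: b :: c :: x => (if (a + 1 = b ∨ b + 1 = a) ∧ a = c then [b :: a :: b :: x] else []) ++
      (braidNeighbors (b :: c :: x)).map (a :: ·)
  | _ => []

theorem mem_commutationNeighbors {x y : List ℤ} :
    y ∈ commutationNeighbors x ↔ IntCommutationMove x y := by
  constructor
  · fun_induction commutationNeighbors x generalizing y with
    | case1 a b x ih =>
      rw [List.mem_append, List.mem_map]
      rintro (h | ⟨z, hz, rfl⟩)
      · split_ifs at h with hab
        · rw [List.mem_singleton.1 h]
          exact ⟨[], x, a, b, hab, rfl, rfl⟩
        · simp at h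
      · obtain ⟨p, q, c, d, hcd, h₁, rfl⟩ := ih hz
        exact ⟨a :: p, q, c, d, hcd, by rw [h₁]; rfl, rfl⟩
    | case2 => simp
  · rintro ⟨p, q, a, b, hab, rfl, rfl⟩
    induction p with
    | nil => simp [commutationNeighbors, hab]
    | cons c p ih =>
      cases p with
      | nil => simpa [commutationNeighbors] using Or.inr ih
      | cons d p => simpa [commutationNeighbors] using Or.inr ih

theorem mem_braidNeighbors {x y : List ℤ} : y ∈ braidNeighbors x ↔ IntBraidMove x y := by
  constructor
  · fun_induction braidNeighbors x generalizing y with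
    | case1 a b c x ih =>
      rw [List.mem_append, List.mem_map]
      rintro (h | ⟨z, hz, rfl⟩)
      · split_ifs at h with hab
        · obtain ⟨hab, rfl⟩ := hab
          rw [List.mem_singleton.1 h]
          exact ⟨[], x, a, b, hab, rfl, rfl⟩
        · simp at h
      · obtain ⟨p, q, c, d, hcd, h₁, rfl⟩ := ih hz
        exact ⟨a :: p, q, c, d, hcd, by rw [h₁]; rfl, rfl⟩
    | case2 => simp
  · rintro ⟨p, q, a, b, hab, rfl, rfl⟩
    induction p with
    | nil => simp [braidNeighbors, hab]
    | cons c p ih =>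
      rcases p with _ | ⟨d, _ | ⟨e, p⟩⟩ <;> simpa [braidNeighbors] using Or.inr ih

/-- Addition of `i` to all letters. -/
def shiftWord (i : ℤ) (x : List ℤ) : List ℤ := x.map (i + ·)

/-- Shift equivariance reduces a family indexed by i to concrete words around 0, on which `decide`
works. -/
theorem commutationNeighbors_shiftWord (i : ℤ) (x : List ℤ) :
    commutationNeighbors (shiftWord i x) = (commutationNeighbors x).map (shiftWord i) := by
  fun_induction commutationNeighbors x with
  | case1 a b x ih =>
    have h : (i + a + 1 < i + b ∨ i + b + 1 < i + a) ↔ (a + 1 < b ∨ b + 1 < a) := by omega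
    simp only [shiftWord, List.map_cons] at ih
    simp only [shiftWord, List.map_cons, commutationNeighbors, h, List.map_append, ih,
      List.map_map]
    split_ifs <;> simp [Function.comp_def, shiftWord]
  | case2 x h =>
    rcases x with _ | ⟨a, _ | ⟨b, x⟩⟩
    · rfl
    · rfl
    · exact absurd rfl (h a b x)

theorem braidNeighbors_shiftWord (i : ℤ) (x : List ℤ) :
    braidNeighbors (shiftWord i x) = (braidNeighbors x).map (shiftWord i) := by
  fun_induction braidNeighbors x with
  | case1 a b c x ih =>
    have h : ((i + a + 1 = i + b ∨ i + b + 1 = i + a) ∧ i + a = i + c) ↔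
      ((a + 1 = b ∨ b + 1 = a) ∧ a = c) := by omega
    simp only [shiftWord, List.map_cons] at ih
    simp only [shiftWord, List.map_cons, braidNeighbors, h, List.map_append, ih,
      List.map_map]
    split_ifs <;> simp [Function.comp_def, shiftWord]
  | case2 x h =>
    rcases x with _ | ⟨a, _ | ⟨b, _ | ⟨c, x⟩⟩⟩
    · rfl
    · rfl
    · rfl
    · exact absurd rfl (h a b c x)

theorem moveClosed_shiftWord (i : ℤ) {L : List (List ℤ)}
    (hc : ∀ x ∈ L, ∀ y ∈ commutationNeighbors x, y ∈ L)
    (hb : ∀ x ∈ L, ∀ y ∈ braidNeighbors x, y ∈ L) :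
    MoveClosed {y | y ∈ L.map (shiftWord i)} := by
  intro x y hx h
  simp only [Set.mem_ofPred_eq, List.mem_map] at hx ⊢
  obtain ⟨x, hx, rfl⟩ := hx
  rcases h with h | h
  · rw [← mem_commutationNeighbors, commutationNeighbors_shiftWord, List.mem_map] at h
    obtain ⟨y, hy, rfl⟩ := h
    exact ⟨y, hc x hx y hy, rfl⟩
  · rw [← mem_braidNeighbors, braidNeighbors_shiftWord, List.mem_map] at h
    obtain ⟨y, hy, rfl⟩ := h
    exact ⟨y, hb x hx y hy, rfl⟩

/-- The word `c` serves as a centre: every word with a neighbour lies within two steps of it, so any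
two are joined through it. -/
theorem singleClass_shiftWord (i : ℤ) {r : List ℤ → List ℤ → Prop} {nb : List ℤ → List (List ℤ)}
    (hr : ∀ {x y}, r x y → r y x) (hnb : ∀ {x y}, y ∈ nb x ↔ r x y)
    (hi : ∀ x, nb (shiftWord i x) = (nb x).map (shiftWord i)) {L : List (List ℤ)} (c : List ℤ)
    (h : ∀ x ∈ L, nb x ≠ [] → x ∈ c :: nb c ++ (nb c).flatMap nb) :
    SingleClass r {y | y ∈ L.map (shiftWord i)} := by
  have hs : ∀ {x y}, r x y → r (shiftWord i x) (shiftWord i y) := fun h => by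
    rw [← hnb, hi]
    exact List.mem_map_of_mem (hnb.2 h)
  have key : ∀ x y, x ∈ L.map (shiftWord i) → r x y →
      Relation.ReflTransGen r (shiftWord i c) x := by
    intro x y hx hxy
    obtain ⟨x, hx₀, rfl⟩ := List.mem_map.1 hx
    rw [← hnb, hi] at hxy
    have := h x hx₀ (by rintro h; simp [h] at hxy)
    simp only [List.cons_append, List.mem_cons, List.mem_append, List.mem_flatMap] at this
    rcases this with rfl | h | ⟨z, hz, h⟩
    · exact .refl
    · exact .single (hs (hnb.1 h))
    · exact .tail (.single (hs (hnb.1 hz))) (hs (hnb.1 h))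
  intro x y x' y' hx hx' h h'
  have : Std.Symm r := ⟨fun _ _ => hr⟩
  exact (Std.Symm.symm _ _ (key x y hx h)).trans (key x' y' hx' h')

theorem tame_finite_braid (i : ℤ) : Tame [i, i + 1, i, i - 1, i] := by
  refine ⟨{y | y ∈ List.map (shiftWord i) [[0, 1, 0, -1, 0], [1, 0, 1, -1, 0], [1, 0, -1, 1, 0],
    [0, 1, -1, 0, -1], [0, -1, 1, 0, -1]]}, moveClosed_shiftWord i (by decide) (by decide), ?_,
    Or.inl (singleClass_shiftWord i IntBraidMove.symm mem_braidNeighbors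
      (braidNeighbors_shiftWord i) [0, 1, 0, -1, 0] (by decide))⟩
  simp [shiftWord, sub_eq_add_neg]

theorem tame_finite_commutation (i : ℤ) : Tame [i - 1, i, i + 1, i, i - 1] := by
  refine ⟨{y | y ∈ List.map (shiftWord i) [[-1, 0, 1, 0, -1], [-1, 1, 0, 1, -1],
    [1, -1, 0, 1, -1], [-1, 1, 0, -1, 1], [1, -1, 0, -1, 1], [1, 0, -1, 0, 1]]},
    moveClosed_shiftWord i (by decide) (by decide), ?_,
    Or.inr (singleClass_shiftWord i IntCommutationMove.symm mem_commutationNeighbors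
      (commutationNeighbors_shiftWord i) [-1, 1, 0, 1, -1] (by decide))⟩
  simp [shiftWord, sub_eq_add_neg]

/-! ### Runs with one inserted letter. -/

/-- A run of consecutive increasing integers. -/
def IsRun (r : List ℤ) : Prop := r.IsChain fun a b => b = a + 1

theorem IsRun.pairwise {r : List ℤ} (h : IsRun r) : r.Pairwise (· < ·) :=
  List.isChain_iff_pairwise.1 (List.IsChain.imp (fun a b (h : b = a + 1) => by omega) h)

theorem IsRun.eq_succ {r p q : List ℤ} {a b : ℤ} (h : IsRun r) (hr : r = p ++ a :: b :: q) :
    b = a + 1 := by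
  subst hr
  exact (List.isChain_cons_cons.1 (List.isChain_append.1 h).2.1).1

theorem IsRun.lt_of_mem {r p q : List ℤ} (h : IsRun r) (hr : r = p ++ q) {a b : ℤ}
    (ha : a ∈ p) (hb : b ∈ q) : a < b := by
  subst hr
  exact (List.pairwise_append.1 h.pairwise).2.2 a ha b hb

/-- The words obtained from the run `u i (i+1) v` by inserting a second letter `i` after `i+1` or a
second letter `i+1` before `i`. -/
def insertedWords (i : ℤ) (u v : List ℤ) : Set (List ℤ) :=
  {y | ∃ r₁ r₂ c, r₁ ++ r₂ = u ++ i :: (i + 1) :: v ∧ y = r₁ ++ c :: r₂ ∧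
    (c = i ∧ i + 1 ∈ r₁ ∨ c = i + 1 ∧ i ∈ r₂)}

/-- Adjacent letters of a run differ by 1, so the inserted letter must take part and merely shifts
one place. It cannot cross the letter its side condition mentions, as the two do not commute. -/
theorem insertedWords_commutation {i : ℤ} {u v : List ℤ} (h : IsRun (u ++ i :: (i + 1) :: v))
    {x y : List ℤ} (hx : x ∈ insertedWords i u v) (hxy : IntCommutationMove x y) :
    y ∈ insertedWords i u v := by
  obtain ⟨r₁, r₂, c, hr, rfl, hc⟩ := hx
  obtain ⟨p, q, a, b, hab, heq, rfl⟩ := hxy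
  rw [← hr] at h
  simp only [List.append_assoc, List.cons_append, List.nil_append] at heq ⊢
  have key : (r₁ = p ∧ a = c ∧ r₂ = b :: q) ∨ (r₁ = p ++ [a] ∧ b = c ∧ r₂ = q) := by
    rcases List.append_eq_append_iff.1 heq with ⟨s, rfl, h₂⟩ | ⟨s, rfl, h₂⟩
    · rcases s with _ | ⟨d, s⟩
      · simp_all
      · simp only [List.cons_append, List.cons.injEq] at h₂
        have := h.eq_succ (p := r₁ ++ s) (a := a) (b := b) (q := q) (by simp [h₂.2])
        omega
    · rcases s with _ | ⟨d, _ | ⟨e, s⟩⟩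
      · simp_all
      · simp_all
      · simp only [List.cons_append, List.cons.injEq] at h₂
        have := h.eq_succ (p := p) (a := d) (b := e) (q := s ++ r₂) (by simp)
        omega
  rcases key with ⟨rfl, rfl, rfl⟩ | ⟨rfl, rfl, rfl⟩
  · refine ⟨r₁ ++ [b], q, a, by simpa using hr, by simp, ?_⟩
    rcases hc with ⟨rfl, hc⟩ | ⟨rfl, hc⟩
    · exact Or.inl ⟨rfl, by simp [hc]⟩
    · refine Or.inr ⟨rfl, ?_⟩
      rcases List.mem_cons.1 hc with h | h
      · omega
      · exact h
  · refine ⟨p, a :: r₂, b, by simpa using hr, by simp, ?_⟩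
    rcases hc with ⟨rfl, hc⟩ | ⟨rfl, hc⟩
    · refine Or.inl ⟨rfl, ?_⟩
      rcases List.mem_append.1 hc with h | h
      · exact h
      · rw [List.mem_singleton] at h
        omega
    · exact Or.inr ⟨rfl, by simp [hc]⟩

/-- A braid factor repeats a letter, so it consists of the inserted letter, its twin in the run and
one run letter between them. This pins down the position. -/
theorem insertedWords_braid {i : ℤ} {u v : List ℤ} (h : IsRun (u ++ i :: (i + 1) :: v))
    {x y : List ℤ} (hx : x ∈ insertedWords i u v) (hxy : IntBraidMove x y) :
    (x = u ++ [i, i + 1, i] ++ v ∧ y = u ++ [i + 1, i, i + 1] ++ v) ∨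
    (x = u ++ [i + 1, i, i + 1] ++ v ∧ y = u ++ [i, i + 1, i] ++ v) := by
  obtain ⟨r₁, r₂, c, hr, rfl, hc⟩ := hx
  obtain ⟨p, q, a, b, hab, heq, rfl⟩ := hxy
  have h' := h
  rw [← hr] at h
  have huniq : ∀ {p q : List ℤ}, p ++ i :: (i + 1) :: q = u ++ i :: (i + 1) :: v →
      p = u ∧ q = v := by
    intro p q hpq
    have hp : i ∉ p := fun hi =>
      absurd (h'.lt_of_mem hpq.symm hi List.mem_cons_self) (lt_irrefl _)
    have hu : i ∉ u := fun hi => absurd (h'.lt_of_mem rfl hi (List.mem_cons_self)) (lt_irrefl _)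
    obtain ⟨h₁, h₂⟩ := List.append_inj hpq (by
      have := congrArg (List.idxOf i) hpq
      simpa [List.idxOf_append_of_notMem hp, List.idxOf_append_of_notMem hu] using this)
    exact ⟨h₁, by simpa using h₂⟩
  simp only [List.append_assoc, List.cons_append, List.nil_append] at heq ⊢
  -- The inserted letter is the first or the last of the factor: if it were the middle one or
  -- outside, the increasing run would repeat `a`.
  have key : (r₁ = p ∧ a = c ∧ r₂ = b :: a :: q) ∨ (r₁ = p ++ [a, b] ∧ a = c ∧ r₂ = q) := by
    rcases List.append_eq_append_iff.1 heq with ⟨s, rfl, h₂⟩ | ⟨s, rfl, h₂⟩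
    · rcases s with _ | ⟨d, s⟩
      · simp only [List.nil_append, List.cons.injEq] at h₂
        exact Or.inl ⟨(List.append_nil _).symm, h₂.1.symm, h₂.2⟩
      · simp only [List.cons_append, List.cons.injEq] at h₂
        have h₃ := h.eq_succ (p := r₁ ++ s) (a := a) (b := b) (q := a :: q) (by simp [h₂.2])
        have h₄ := h.eq_succ (p := r₁ ++ s ++ [a]) (a := b) (b := a) (q := q) (by simp [h₂.2])
        omega
    · rcases s with _ | ⟨d, _ | ⟨e, _ | ⟨f, s⟩⟩⟩
      · simp only [List.nil_append, List.cons.injEq] at h₂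
        exact Or.inl ⟨List.append_nil _, h₂.1, h₂.2.symm⟩
      · simp only [List.cons_append, List.nil_append, List.cons.injEq] at h₂
        have h₃ := h.eq_succ (p := p) (a := d) (b := a) (q := q) (by simp [← h₂.2.2])
        omega
      · simp only [List.cons_append, List.nil_append, List.cons.injEq] at h₂
        exact Or.inr ⟨by rw [h₂.1, h₂.2.1], h₂.2.2.1, h₂.2.2.2.symm⟩
      · simp only [List.cons_append, List.cons.injEq] at h₂
        have h₃ := h.eq_succ (p := p) (a := d) (b := e) (q := f :: s ++ r₂) (by simp)
        have h₄ := h.eq_succ (p := p ++ [d]) (a := e) (b := f) (q := s ++ r₂) (by simp)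
        omega
  rcases key with ⟨rfl, rfl, rfl⟩ | ⟨rfl, rfl, rfl⟩
  · have h₃ := h.eq_succ rfl
    rcases hc with ⟨rfl, hc⟩ | ⟨rfl, hc⟩
    · have := h.lt_of_mem rfl hc (b := a) (by simp)
      omega
    · obtain rfl : b = i := by omega
      obtain ⟨rfl, rfl⟩ := huniq hr
      exact Or.inr ⟨rfl, rfl⟩
  · have h₃ := h.eq_succ (p := p) (a := a) (b := b) (q := r₂) (by simp)
    rcases hc with ⟨rfl, hc⟩ | ⟨rfl, hc⟩
    · subst h₃
      obtain ⟨rfl, rfl⟩ := huniq (p := p) (q := r₂) (by simpa using hr)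
      exact Or.inl ⟨by simp, by simp⟩
    · have := h.lt_of_mem rfl (a := i + 1) (by simp) hc
      omega

theorem mem_insertedWords_left (i : ℤ) (u v : List ℤ) :
    u ++ [i, i + 1, i] ++ v ∈ insertedWords i u v :=
  ⟨u ++ [i, i + 1], v, i, by simp, by simp, Or.inl ⟨rfl, by simp⟩⟩

theorem mem_insertedWords_right (i : ℤ) (u v : List ℤ) :
    u ++ [i + 1, i, i + 1] ++ v ∈ insertedWords i u v :=
  ⟨u, i :: (i + 1) :: v, i + 1, by simp, by simp, Or.inr ⟨rfl, by simp⟩⟩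

theorem tame_of_isRun {i : ℤ} {u v : List ℤ} (h : IsRun (u ++ i :: (i + 1) :: v)) :
    Tame (u ++ [i, i + 1, i] ++ v) := by
  have hb : IntBraidMove (u ++ [i, i + 1, i] ++ v) (u ++ [i + 1, i, i + 1] ++ v) :=
    ⟨u, v, i, i + 1, Or.inl rfl, rfl, rfl⟩
  refine ⟨insertedWords i u v, ?_, mem_insertedWords_left i u v, Or.inl ?_⟩
  · rintro x y hx (hxy | hxy)
    · exact insertedWords_commutation h hx hxy
    · rcases insertedWords_braid h hx hxy with ⟨-, rfl⟩ | ⟨-, rfl⟩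
      · exact mem_insertedWords_right i u v
      · exact mem_insertedWords_left i u v
  · intro x y x' y' hx hx' hxy hxy'
    rcases insertedWords_braid h hx hxy with ⟨rfl, -⟩ | ⟨rfl, -⟩ <;>
      rcases insertedWords_braid h hx' hxy' with ⟨rfl, -⟩ | ⟨rfl, -⟩
    · exact .refl
    · exact .single hb
    · exact .single hb.symm
    · exact .refl

/-! ### Special words attain the bound. -/

theorem increasingRun_eq (a : ℤ) (t : ℕ) :
    increasingRun a t = (List.range (t + 1)).map fun k : ℕ => a + (k : ℤ) := by
  -- The cast to ℤ in the definition unfolds to a `flatMap` of singletons over the range.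
  change List.map _ (List.flatMap (fun k : ℕ => [(k : ℤ)]) _) = _
  rw [← List.map_eq_flatMap, List.map_map]
  rfl

theorem increasingRun_zero (a : ℤ) : increasingRun a 0 = [a] := by
  simp [increasingRun_eq]

theorem increasingRun_succ (a : ℤ) (t : ℕ) :
    increasingRun a (t + 1) = a :: increasingRun (a + 1) t := by
  rw [increasingRun_eq, increasingRun_eq, List.range_succ_eq_map]
  simp only [List.map_cons, List.map_map, Nat.cast_zero, add_zero, List.cons.injEq, true_and]
  refine List.map_congr_left fun k _ => ?_
  simp only [Function.comp_apply]
  push_cast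
  ring

theorem decreasingRun_eq (a : ℤ) (t : ℕ) :
    decreasingRun a t = (List.range (t + 1)).map fun k : ℕ => a - (k : ℤ) := by
  change List.map _ (List.flatMap (fun k : ℕ => [(k : ℤ)]) _) = _
  rw [← List.map_eq_flatMap, List.map_map]
  rfl

theorem decreasingRun_eq_reflectWord (N a : ℤ) (t : ℕ) :
    decreasingRun a t = reflectWord N (increasingRun (N - a) t) := by
  rw [increasingRun_eq, decreasingRun_eq, reflectWord, List.map_map]
  refine List.map_congr_left fun k _ => ?_
  simp only [Function.comp_apply]
  omega

theorem isRun_increasingRun (a : ℤ) (t : ℕ) {q : List ℤ} (h : IsRun ((a + t) :: q)) :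
    IsRun (increasingRun a t ++ q) := by
  induction t generalizing a with
  | zero => simpa [increasingRun_zero] using h
  | succ t ih =>
    have := ih (a + 1) (by convert h using 2; push_cast; ring)
    rw [increasingRun_succ]
    cases t with
    | zero =>
      rw [increasingRun_zero] at this ⊢
      exact List.isChain_cons_cons.2 ⟨rfl, this⟩
    | succ t =>
      rw [increasingRun_succ] at this ⊢
      exact List.isChain_cons_cons.2 ⟨rfl, this⟩

theorem SpecialPair.tame {i : ℤ} {u v : List ℤ} (h : SpecialPair i u v) :
    Tame (u ++ [i, i + 1, i] ++ v) := by
  have hrun : ∀ (i : ℤ) (t' : ℕ), IsRun (i :: (i + 1) :: increasingRun (i + 2) t') := by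
    intro i t'
    have := isRun_increasingRun i (t' + 2) (q := []) (by simp [IsRun])
    rwa [List.append_nil, increasingRun_succ, increasingRun_succ, add_assoc] at this
  rcases h with ⟨rfl, rfl | ⟨t, rfl⟩⟩ | ⟨rfl, rfl⟩ | ⟨t, t', rfl, rfl⟩
  · exact tame_finite_braid i
  -- After this braid move, negating all letters gives an increasing run from -i-1 with a second
  -- -i-1 inserted.
  · apply Tame.of_move (x := [i + 1, i, i + 1] ++ decreasingRun (i - 1) t)
    · exact Or.inr ⟨[], _, i + 1, i, Or.inr rfl, rfl, rfl⟩
    · apply Tame.of_symmetry (wordSymmetry_reflectWord 0)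
      have := tame_of_isRun (u := []) (hrun (-i - 1) t)
      rw [decreasingRun_eq_reflectWord 0]
      convert this using 1
      rw [reflectWord, List.map_append, ← reflectWord, ← reflectWord,
        (wordSymmetry_reflectWord 0).involutive]
      simp [reflectWord]
      ring_nf
      simp
  · exact tame_finite_commutation i
  · apply tame_of_isRun
    apply isRun_increasingRun
    refine List.isChain_cons_cons.2 ⟨by ring, hrun i t'⟩

theorem letters_complement {n : ℕ} (x : List (Fin n)) :
    letters (complement x) = reflectWord (n + 1) (letters x) := by
  rw [letters_eq_map, letters_eq_map, complement, reflectWord, List.map_map, List.map_map]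
  refine List.map_congr_left fun a _ => ?_
  simp only [Function.comp_apply, Fin.val_rev]
  omega

theorem letters_reverse {n : ℕ} (x : List (Fin n)) :
    letters x.reverse = (letters x).reverse := by
  rw [letters_eq_map, letters_eq_map, List.map_reverse]

/-- The form `u i (i+1) i v` for a special pair, for words of integers. -/
def IntSpecialWord (x : List ℤ) : Prop :=
  ∃ (i : ℤ) (u v : List ℤ), x = u ++ [i, i + 1, i] ++ v ∧ SpecialPair i u v

theorem specialWordUpToSymmetry_iff {n : ℕ} {x : List (Fin n)} :
    SpecialWordUpToSymmetry x ↔ IntSpecialWord (letters x) ∨ IntSpecialWord (letters x).reverse ∨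
      IntSpecialWord (reflectWord (n + 1) (letters x)) ∨
      IntSpecialWord (reflectWord (n + 1) (letters x)).reverse := by
  simp only [SpecialWordUpToSymmetry, SpecialWord, IntSpecialWord, letters_complement,
    letters_reverse]

theorem attainsLowerBound_of_special {n : ℕ} {w : Equiv.Perm (Fin (n + 1))} {x : List (Fin n)}
    (hx : x ∈ reducedWords w) (h : SpecialWordUpToSymmetry x) : AttainsLowerBound w := by
  refine Tame.attainsLowerBound (x := letters x) ?_ ⟨x, hx, rfl⟩
  have key : ∀ {y}, IntSpecialWord y → Tame y := by
    rintro _ ⟨i, u, v, rfl, h⟩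
    exact h.tame
  rcases specialWordUpToSymmetry_iff.1 h with h | h | h | h
  · exact key h
  · exact (key h).of_symmetry wordSymmetry_reverse
  · exact (key h).of_symmetry (wordSymmetry_reflectWord _)
  · exact ((key h).of_symmetry wordSymmetry_reverse).of_symmetry (wordSymmetry_reflectWord _)

/-! ### Factors forbidden in a circuit-free set. -/

theorem CircuitFreeSet.mem_of_reflTransGen {S : Set (List ℤ)} (hS : CircuitFreeSet S)
    {x y : List ℤ} (hx : x ∈ S) (h : Relation.ReflTransGen IntMove x y) : y ∈ S := by
  induction h with
  | refl => exact hx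
  | tail _ hm ih => exact hS.closed ih hm

theorem CircuitFreeSet.commutation_mem {S : Set (List ℤ)} (hS : CircuitFreeSet S)
    {p q : List ℤ} {a b : ℤ} (h : p ++ a :: b :: q ∈ S) (hab : a + 1 < b ∨ b + 1 < a) :
    p ++ b :: a :: q ∈ S :=
  hS.closed h (Or.inl ⟨p, q, a, b, hab, by simp, by simp⟩)

theorem CircuitFreeSet.braid_mem {S : Set (List ℤ)} (hS : CircuitFreeSet S)
    {p q : List ℤ} {a b : ℤ} (h : p ++ a :: b :: a :: q ∈ S) (hab : a + 1 = b ∨ b + 1 = a) :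
    p ++ b :: a :: b :: q ∈ S :=
  hS.closed h (Or.inr ⟨p, q, a, b, hab, by simp, by simp⟩)

theorem CircuitFreeSet.ne_of_mem {S : Set (List ℤ)} (hS : CircuitFreeSet S)
    {p q : List ℤ} {a b : ℤ} (h : p ++ a :: b :: q ∈ S) : a ≠ b := by
  rintro rfl
  exact hS.no_square p a q (by simpa using h)

/-- A braid move on the first three letters creates a square. -/
theorem CircuitFreeSet.no_alternating {S : Set (List ℤ)} (hS : CircuitFreeSet S)
    {p q : List ℤ} {a b : ℤ} (hab : a + 1 = b ∨ b + 1 = a) : p ++ a :: b :: a :: b :: q ∉ S := by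
  intro h
  exact hS.ne_of_mem (p := p ++ [b, a]) (q := q) (by simpa using hS.braid_mem h hab) rfl

/-- A commutation move and a later braid move with disjoint supports yield a circuit. -/
theorem CircuitFreeSet.no_commutation_braid {S : Set (List ℤ)} (hS : CircuitFreeSet S)
    {p q r : List ℤ} {a b c d : ℤ} (hab : a + 1 < b ∨ b + 1 < a) (hcd : c + 1 = d ∨ d + 1 = c) :
    p ++ a :: b :: (q ++ c :: d :: c :: r) ∉ S := by
  intro hx
  have hne : a ≠ b := by omega
  refine hS.separates hx (y := p ++ a :: b :: (q ++ d :: c :: d :: r))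
    (z := p ++ b :: a :: (q ++ c :: d :: c :: r)) ?_ ?_ ?_
  · exact ⟨p ++ a :: b :: q, r, c, d, hcd, by simp, by simp⟩
  · exact ⟨p, q ++ c :: d :: c :: r, a, b, hab, by simp, by simp⟩
  · refine .tail (.single (b := p ++ b :: a :: (q ++ d :: c :: d :: r)) ⟨Or.inl ?_, ?_⟩)
      ⟨Or.inr ?_, ?_⟩
    · exact ⟨p, q ++ d :: c :: d :: r, a, b, hab, by simp, by simp⟩
    · simp [hne.symm]
    · exact ⟨p ++ b :: a :: q, r, d, c, hcd.symm, by simp, by simp⟩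
    · simp [hne.symm]

/-- A braid move and a later commutation move with disjoint supports yield a circuit. -/
theorem CircuitFreeSet.no_braid_commutation {S : Set (List ℤ)} (hS : CircuitFreeSet S)
    {p q r : List ℤ} {a b c d : ℤ} (hab : a + 1 < b ∨ b + 1 < a) (hcd : c + 1 = d ∨ d + 1 = c) :
    p ++ c :: d :: c :: (q ++ a :: b :: r) ∉ S := by
  intro hx
  apply (hS.preimage wordSymmetry_reverse).no_commutation_braid (p := r.reverse)
    (q := q.reverse) (r := p.reverse) hab.symm hcd
  simpa using hx

/-- A braid move followed by a letter commuting with both of its letters yields a circuit. -/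
theorem CircuitFreeSet.no_braid_disjoint {S : Set (List ℤ)} (hS : CircuitFreeSet S)
    {p q : List ℤ} {a b c : ℤ} (hab : a + 1 = b ∨ b + 1 = a) (hca : c + 1 < a ∨ a + 1 < c)
    (hcb : c + 1 < b ∨ b + 1 < c) : p ++ a :: b :: a :: c :: q ∉ S := by
  intro hx
  have h₁ : a ≠ b := by omega
  have h₂ : c ≠ a := by omega
  have h₃ : c ≠ b := by omega
  refine hS.separates hx (y := p ++ b :: a :: b :: c :: q) (z := p ++ a :: b :: c :: a :: q)
    ⟨p, c :: q, a, b, hab, by simp, by simp⟩ ⟨p ++ [a, b], q, a, c, hca.symm, by simp, by simp⟩ ?_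
  -- Carry `c` leftwards past b a b, undo the braid behind it, then bring `c` back to just before
  -- the last `a`.
  refine .head (b := p ++ b :: a :: c :: b :: q)
    ⟨Or.inl ⟨p ++ [b, a], q, b, c, hcb.symm, by simp, by simp⟩, by simp [h₁.symm]⟩ ?_
  refine .head (b := p ++ b :: c :: a :: b :: q)
    ⟨Or.inl ⟨p ++ [b], b :: q, a, c, hca.symm, by simp, by simp⟩, by simp [h₁.symm]⟩ ?_
  refine .head (b := p ++ c :: b :: a :: b :: q)
    ⟨Or.inl ⟨p, a :: b :: q, b, c, hcb.symm, by simp, by simp⟩, by simp [h₂]⟩ ?_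
  refine .head (b := p ++ c :: a :: b :: a :: q)
    ⟨Or.inr ⟨p ++ [c], q, b, a, hab.symm, by simp, by simp⟩, by simp [h₂]⟩ ?_
  refine .head (b := p ++ a :: c :: b :: a :: q)
    ⟨Or.inl ⟨p, b :: a :: q, c, a, hca, by simp, by simp⟩, by simp [h₃]⟩ ?_
  exact .single
    ⟨Or.inl ⟨p ++ [a], a :: q, c, b, hcb, by simp, by simp⟩, by simp [h₂]⟩

/-- A braid move preceded by a letter commuting with both of its letters yields a circuit. -/
theorem CircuitFreeSet.no_disjoint_braid {S : Set (List ℤ)} (hS : CircuitFreeSet S)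
    {p q : List ℤ} {a b c : ℤ} (hab : a + 1 = b ∨ b + 1 = a) (hca : c + 1 < a ∨ a + 1 < c)
    (hcb : c + 1 < b ∨ b + 1 < c) : p ++ c :: a :: b :: a :: q ∉ S := by
  intro hx
  apply (hS.preimage wordSymmetry_reverse).no_braid_disjoint (p := q.reverse)
    (q := p.reverse) hab hca hcb
  simpa using hx

theorem IntMove.symm {x y : List ℤ} (h : IntMove x y) : IntMove y x :=
  h.imp IntCommutationMove.symm IntBraidMove.symm

theorem IntMove.append {x y : List ℤ} (h : IntMove x y) (p q : List ℤ) :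
    IntMove (p ++ x ++ q) (p ++ y ++ q) := by
  rcases h with ⟨p', q', a, b, hab, rfl, rfl⟩ | ⟨p', q', a, b, hab, rfl, rfl⟩
  · exact Or.inl ⟨p ++ p', q' ++ q, a, b, hab, by simp, by simp⟩
  · exact Or.inr ⟨p ++ p', q' ++ q, a, b, hab, by simp, by simp⟩

theorem IntMove.shiftWord {x y : List ℤ} (h : IntMove x y) (i : ℤ) :
    IntMove (shiftWord i x) (shiftWord i y) := by
  rcases h with ⟨p, q, a, b, hab, rfl, rfl⟩ | ⟨p, q, a, b, hab, rfl, rfl⟩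
  · exact Or.inl ⟨ReducedWords.shiftWord i p, ReducedWords.shiftWord i q, i + a, i + b, by omega,
      by simp [ReducedWords.shiftWord], by simp [ReducedWords.shiftWord]⟩
  · exact Or.inr ⟨ReducedWords.shiftWord i p, ReducedWords.shiftWord i q, i + a, i + b, by omega,
      by simp [ReducedWords.shiftWord], by simp [ReducedWords.shiftWord]⟩

theorem shiftWord_injective (i : ℤ) : Function.Injective (shiftWord i) :=
  List.map_injective_iff.2 (add_right_injective i)

/-- All words obtained by a single move. -/
def neighbors (x : List ℤ) : List (List ℤ) := commutationNeighbors x ++ braidNeighbors x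

theorem mem_neighbors {x y : List ℤ} : y ∈ neighbors x ↔ IntMove x y := by
  rw [neighbors, List.mem_append, mem_commutationNeighbors, mem_braidNeighbors, IntMove]

theorem reflTransGen_of_isChain {α : Type*} {r : α → α → Prop} {a : α} {l : List α}
    (h : (a :: l).IsChain r) {b : α} (hb : b ∈ a :: l) : Relation.ReflTransGen r a b := by
  induction l generalizing a with
  | nil =>
    rw [List.mem_singleton.1 hb]
  | cons c l ih =>
    rw [List.isChain_cons_cons] at h
    rcases List.mem_cons.1 hb with rfl | hb
    · exact .refl
    · exact .head h.1 (ih h.2 hb)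

/-- No reduced word of a circuit-free permutation has a factor which is a reduced word of the
longest element of a symmetric group on four letters. -/
theorem CircuitFreeSet.no_longest {S : Set (List ℤ)} (hS : CircuitFreeSet S) (p q : List ℤ) (i : ℤ)
    {l : List ℤ} (hl : l ∈ [[3, 2, 1, 2, 3, 2], [3, 2, 1, 3, 2, 3], [3, 2, 3, 1, 2, 3],
      [2, 3, 2, 1, 2, 3], [2, 3, 1, 2, 1, 3], [2, 1, 3, 2, 1, 3], [2, 1, 3, 2, 3, 1],
      [2, 1, 2, 3, 2, 1], [1, 2, 1, 3, 2, 1], [1, 2, 3, 1, 2, 1], [1, 2, 3, 2, 1, 2],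
      [1, 3, 2, 3, 1, 2], [1, 3, 2, 1, 3, 2]]) : p ++ shiftWord i l ++ q ∉ S := by
  intro h
  -- The chain leads from a braid neighbour of 312132 to a commutation neighbour of it while
  -- avoiding 312132, contradicting separation at that word.
  have hchain : List.IsChain (fun x y => y ∈ neighbors x ∧ y ≠ [3, 1, 2, 1, 3, 2])
    [[3, 2, 1, 2, 3, 2], [3, 2, 1, 3, 2, 3], [3, 2, 3, 1, 2, 3],
      [2, 3, 2, 1, 2, 3], [2, 3, 1, 2, 1, 3], [2, 1, 3, 2, 1, 3], [2, 1, 3, 2, 3, 1],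
      [2, 1, 2, 3, 2, 1], [1, 2, 1, 3, 2, 1], [1, 2, 3, 1, 2, 1], [1, 2, 3, 2, 1, 2],
      [1, 3, 2, 3, 1, 2], [1, 3, 2, 1, 3, 2]] := by decide
  have key : ∀ {l}, l ∈ _ → Relation.ReflTransGen
      (fun x y => IntMove x y ∧ y ≠ p ++ shiftWord i [3, 1, 2, 1, 3, 2] ++ q)
      (p ++ shiftWord i [3, 2, 1, 2, 3, 2] ++ q) (p ++ shiftWord i l ++ q) := fun hl =>
    (reflTransGen_of_isChain hchain hl).lift (fun l => p ++ shiftWord i l ++ q) fun x y h =>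
      ⟨((mem_neighbors.1 h.1).shiftWord i).append p q, by
        simpa using fun h' => h.2 (shiftWord_injective i h')⟩
  have hx : p ++ shiftWord i [3, 1, 2, 1, 3, 2] ++ q ∈ S := by
    have : Std.Symm IntMove := ⟨fun _ _ => IntMove.symm⟩
    have hy := (key hl).lift id fun _ _ h => h.1
    have hmem := hS.mem_of_reflTransGen h (Std.Symm.symm _ _ hy)
    exact hS.closed hmem (((mem_neighbors.1 (by decide :
      [3, 1, 2, 1, 3, 2] ∈ neighbors [3, 2, 1, 2, 3, 2])).shiftWord i).append p q)
  refine hS.separates hx ?_ ?_ (key (l := [1, 3, 2, 1, 3, 2]) (by simp))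
  · exact ⟨p ++ [i + 3], [i + 3, i + 2] ++ q, i + 1, i + 2, by omega, by simp [shiftWord],
      by simp [shiftWord]⟩
  · exact ⟨p, [i + 2, i + 1, i + 3, i + 2] ++ q, i + 3, i + 1, by omega, by simp [shiftWord],
      by simp [shiftWord]⟩

/-! ### Growing the allowed words on both sides of a braid. -/

theorem increasingRun_succ_last (a : ℤ) (t : ℕ) :
    increasingRun a (t + 1) = increasingRun a t ++ [a + t + 1] := by
  rw [increasingRun_eq, increasingRun_eq, List.range_succ, List.map_append]
  simp [add_assoc]

/-- The next letter neither equals nor commutes with the last one, so it continues the run or turns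
back. Turning back is excluded by `hv` when t = 0. When t = 1 a braid moves i+3 next to the factor,
and for larger t the new braid is disjoint from the commuting pair i, i+2. -/
theorem CircuitFreeSet.right_run {S : Set (List ℤ)} (hS : CircuitFreeSet S) {i : ℤ} {u : List ℤ}
    (v : List ℤ) (t : ℕ) (h : u ++ i :: (i + 1) :: i :: (increasingRun (i + 2) t ++ v) ∈ S)
    (hv : t = 0 → ∀ v', v ≠ (i + 1) :: v') :
    ∃ t', increasingRun (i + 2) t ++ v = increasingRun (i + 2) t' := by
  induction v generalizing t with
  | nil => exact ⟨t, by simp⟩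
  | cons b v ih =>
    obtain ⟨s, hs⟩ : ∃ s, increasingRun (i + 2) t = s ++ [i + 2 + t] := by
      cases t with
      | zero => exact ⟨[], by simp [increasingRun_zero]⟩
      | succ t => exact ⟨_, by rw [increasingRun_succ_last]; push_cast; rw [add_assoc _ (t : ℤ)]⟩
    have h₁ : ¬ (i + 2 + t + 1 < b ∨ b + 1 < i + 2 + t) := fun hc =>
      hS.no_braid_commutation (p := u) (q := s) (r := v) (c := i) (d := i + 1) hc (Or.inl rfl)
        (by simpa [hs] using h)
    have h₂ : i + 2 + t ≠ b := hS.ne_of_mem (p := u ++ i :: (i + 1) :: i :: s) (q := v)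
      (by simpa [hs] using h)
    by_cases h₃ : b = i + 2 + t + 1
    · subst h₃
      have h₄ : increasingRun (i + 2) t ++ (i + 2 + t + 1) :: v =
          increasingRun (i + 2) (t + 1) ++ v := by simp [increasingRun_succ_last]
      rw [h₄] at h ⊢
      exact ih (t + 1) h (by omega)
    · obtain rfl : b = i + 1 + t := by omega
      exfalso
      rcases t with _ | _ | t
      · exact hv rfl v (by simp)
      · simp only [increasingRun_succ, increasingRun_zero, Nat.cast_one, zero_add,
          List.cons_append, List.nil_append] at h
        have := hS.braid_mem (p := u ++ [i, i + 1, i]) (a := i + 2) (b := i + 2 + 1) (q := v)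
          (by simpa [add_assoc] using h) (Or.inl rfl)
        exact hS.no_braid_disjoint (p := u) (a := i) (b := i + 1) (c := i + 2 + 1)
          (q := (i + 2) :: (i + 2 + 1) :: v) (by omega) (by omega) (by omega)
          (by simpa using this)
      · rw [increasingRun_succ_last, increasingRun_succ_last] at h
        obtain ⟨s, hs⟩ : ∃ s, increasingRun (i + 2) t = (i + 2) :: s := by
          cases t with
          | zero => exact ⟨[], increasingRun_zero _⟩
          | succ t => exact ⟨_, increasingRun_succ _ _⟩
        refine hS.no_commutation_braid (p := u ++ [i, i + 1]) (a := i) (b := i + 2) (q := s)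
          (c := i + 2 + t + 1) (d := i + 2 + t + 1 + 1) (r := v) (by omega) (by omega) ?_
        rw [hs] at h
        convert h using 1
        simp
        omega

/-- A letter turning back upwards would complete a braid disjoint from the later commuting pair i,
i+2. This includes t = 0, where that braid uses only the first i of the factor. -/
theorem CircuitFreeSet.left_run {S : Set (List ℤ)} (hS : CircuitFreeSet S) {i : ℤ} {v : List ℤ}
    (u : List ℤ) (t : ℕ)
    (h : u ++ increasingRun (i - 1 - t) t ++ i :: (i + 1) :: i :: (i + 2) :: v ∈ S) :
    ∃ t' : ℕ, u ++ increasingRun (i - 1 - t) t = increasingRun (i - 1 - t') t' := by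
  induction u using List.reverseRecOn generalizing t with
  | nil => exact ⟨t, by simp⟩
  | append_singleton u e ih =>
    obtain ⟨s, hs⟩ : ∃ s, increasingRun (i - 1 - t) t = (i - 1 - t) :: s := by
      cases t with
      | zero => exact ⟨[], increasingRun_zero _⟩
      | succ t => exact ⟨_, increasingRun_succ _ _⟩
    have h₁ : ¬ (e + 1 < i - 1 - t ∨ i - 1 - t + 1 < e) := fun hc =>
      hS.no_commutation_braid (p := u) (q := s) (r := (i + 2) :: v) (c := i) (d := i + 1) hc
        (Or.inl rfl) (by simpa [hs] using h)
    have h₂ : e ≠ i - 1 - t := hS.ne_of_mem (p := u)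
      (q := s ++ i :: (i + 1) :: i :: (i + 2) :: v) (by simpa [hs] using h)
    by_cases h₃ : e = i - 1 - (t + 1 : ℕ)
    · subst h₃
      have h₄ : u ++ [i - 1 - ((t + 1 : ℕ) : ℤ)] ++ increasingRun (i - 1 - t) t =
          u ++ increasingRun (i - 1 - ((t + 1 : ℕ) : ℤ)) (t + 1) := by
        have : i - 1 - ((t + 1 : ℕ) : ℤ) + 1 = i - 1 - t := by push_cast; ring
        rw [increasingRun_succ, this]
        simp
      rw [h₄] at h ⊢
      exact ih (t + 1) h
    · obtain rfl : e = i - 1 - t + 1 := by omega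
      exfalso
      obtain ⟨s, hs⟩ : ∃ s, increasingRun (i - 1 - t) t ++ [i] =
          (i - 1 - t) :: (i - 1 - t + 1) :: s := by
        rcases t with _ | _ | t
        · exact ⟨[], by simp [increasingRun_zero]⟩
        · exact ⟨[i], by simp [increasingRun_succ, increasingRun_zero]⟩
        · exact ⟨_, by rw [increasingRun_succ, increasingRun_succ]; rfl⟩
      refine hS.no_braid_commutation (p := u) (c := i - 1 - t + 1) (d := i - 1 - t)
        (q := s ++ [i + 1]) (a := i) (b := i + 2) (r := v) (by omega) (by omega) ?_
      convert h using 1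
      have : u ++ [i - 1 - (t : ℤ) + 1] ++ increasingRun (i - 1 - t) t ++
          i :: (i + 1) :: i :: (i + 2) :: v = u ++ [i - 1 - (t : ℤ) + 1] ++
          ((increasingRun (i - 1 - t) t ++ [i]) ++ (i + 1) :: i :: (i + 2) :: v) := by simp
      rw [this, hs]
      simp

/-- The letter before the factor decides the family. If there is none, a braid move and
complementation give empty `u`; i-1 gives runs on both sides; i+2 forces the word (i+2) i (i+1) i
(i+2), which moves to the palindrome i (i+1)(i+2)(i+1) i. -/
theorem CircuitFreeSet.exists_special_of_factor {S : Set (List ℤ)} (hS : CircuitFreeSet S)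
    (N : ℤ) {i : ℤ} {u v : List ℤ} (h : u ++ i :: (i + 1) :: i :: (i + 2) :: v ∈ S) :
    ∃ y ∈ S, IntSpecialWord y ∨ IntSpecialWord (reflectWord N y) := by
  have hf : ∀ f v', v = f :: v' → f = i + 1 ∨ f = i + 3 := by
    rintro f v' rfl
    have h₁ : i + 2 ≠ f := hS.ne_of_mem (p := u ++ [i, i + 1, i]) (q := v') (by simpa using h)
    by_contra hc
    exact hS.no_braid_commutation (p := u) (c := i) (d := i + 1) (q := []) (a := i + 2) (b := f)
      (r := v') (by omega) (by omega) h
  have hd : ∀ u' d, u = u' ++ [d] → d = i - 1 ∨ d = i + 2 := by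
    rintro u' d rfl
    have h₁ : d ≠ i := hS.ne_of_mem (p := u') (q := (i + 1) :: i :: (i + 2) :: v)
      (by simpa using h)
    have h₂ : d ≠ i + 1 := by
      rintro rfl
      have := hS.braid_mem (p := u' ++ [i + 1]) (q := (i + 2) :: v) (a := i) (b := i + 1)
        (by simpa using h) (Or.inl rfl)
      exact hS.ne_of_mem (p := u') (q := i :: (i + 1) :: (i + 2) :: v) (by simpa using this) rfl
    by_contra hc
    exact hS.no_disjoint_braid (p := u') (c := d) (a := i) (b := i + 1) (q := (i + 2) :: v)
      (Or.inl rfl) (by omega) (by omega) (by simpa using h)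
  rcases List.eq_nil_or_concat u with rfl | ⟨u, d, rfl⟩
  · have hrun := hS.right_run (u := []) (i := i) v 0 (by simpa [increasingRun_zero] using h)
    rcases v with _ | ⟨f, v⟩
    · refine ⟨_, hS.braid_mem (p := []) h (Or.inl rfl), Or.inr ?_⟩
      -- Complementing (i+1) i (i+1) gives j (j+1) j with j = N - (i+1), and i+2 becomes j-1.
      exact ⟨N - (i + 1), [], [N - (i + 2)], by simp [reflectWord]; ring, Or.inl ⟨rfl, Or.inr
        ⟨0, by simp [decreasingRun_eq]; ring⟩⟩⟩
    · rcases hf f v rfl with rfl | rfl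
      · obtain rfl : v = [] := by
          rcases v with _ | ⟨g, v⟩
          · rfl
          exfalso
          have h₁ : i + 1 ≠ g := hS.ne_of_mem (p := [i, i + 1, i, i + 2]) (q := v) h
          by_cases h₂ : g = i
          · subst h₂
            apply hS.no_longest [] v (g - 1) (l := [1, 2, 1, 3, 2, 1]) (by simp)
            convert h using 1
            simp [shiftWord]
            omega
          by_cases h₃ : g = i + 2
          · subst h₃
            have h₄ := hS.braid_mem (p := [i, i + 1, i]) (a := i + 2) (b := i + 1) (q := v) h
              (by omega)
            exact hS.no_alternating (p := []) (a := i) (b := i + 1)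
              (q := (i + 2) :: (i + 1) :: v) (Or.inl rfl) h₄
          · exact hS.no_braid_commutation (p := []) (c := i) (d := i + 1) (q := [i + 2])
              (a := i + 1) (b := g) (r := v) (by omega) (by omega) h
        refine ⟨_, hS.braid_mem (p := []) h (Or.inl rfl), Or.inr ?_⟩
        refine ⟨N - (i + 1), [], [N - (i + 2), N - (i + 1)], by simp [reflectWord]; ring,
          Or.inl ⟨rfl, Or.inl ?_⟩⟩
        simp
        ring
      · obtain ⟨t, ht⟩ := hrun fun _ v' hv' => by simp at hv'
        refine ⟨_, hS.braid_mem (p := []) h (Or.inl rfl), Or.inr ?_⟩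
        refine ⟨N - (i + 1), [], reflectWord N ((i + 2) :: (i + 3) :: v), by
          simp [reflectWord]; ring, Or.inl ⟨rfl, Or.inr ⟨t, ?_⟩⟩⟩
        rw [decreasingRun_eq_reflectWord N]
        rw [increasingRun_zero] at ht
        rw [show N - (N - (i + 1) - 1) = i + 2 by ring, ← ht]
        rfl
  · simp only [List.concat_eq_append, List.append_assoc, List.cons_append, List.nil_append] at h hd
    rcases hd u d rfl with rfl | rfl
    · have hfne : ∀ v', v ≠ (i + 1) :: v' := by
        rintro v' rfl
        have h₁ := hS.braid_mem (p := u ++ [i - 1]) (a := i) (b := i + 1)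
          (q := (i + 2) :: (i + 1) :: v') (by simpa using h) (Or.inl rfl)
        exact hS.no_commutation_braid (p := u) (a := i - 1) (b := i + 1) (q := [i]) (c := i + 1)
          (d := i + 2) (r := v') (by omega) (by omega) (by simpa using h₁)
      obtain ⟨t', ht'⟩ := hS.right_run (u := u ++ [i - 1]) (i := i) v 0
        (by simpa [increasingRun_zero] using h) fun _ => hfne
      obtain ⟨t, ht⟩ := hS.left_run (i := i) (v := v) u 0
        (by simpa [increasingRun_zero] using h)
      rw [increasingRun_zero] at ht ht'
      refine ⟨_, h, Or.inl ⟨i, u ++ [i - 1], (i + 2) :: v, by simp,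
        Or.inr (Or.inr ⟨t, t', ?_, ht'⟩)⟩⟩
      rw [← ht]
      simp
    · obtain rfl : v = [] := by
        rcases v with _ | ⟨f, v⟩
        · rfl
        exfalso
        rcases hf f v rfl with rfl | rfl
        · have h₁ := hS.commutation_mem (p := u) h (by omega)
          apply hS.no_longest u v (i - 1) (l := [1, 3, 2, 1, 3, 2]) (by simp)
          convert h₁ using 1
          simp [shiftWord]
          omega
        · have h₁ := hS.commutation_mem (p := u) h (by omega)
          have h₂ := hS.commutation_mem (p := u ++ [i, i + 2, i + 1]) (a := i) (b := i + 2)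
            (q := (i + 3) :: v) (by simpa using h₁) (by omega)
          exact hS.no_braid_commutation (p := u ++ [i]) (c := i + 2) (d := i + 1) (q := [])
            (a := i) (b := i + 3) (r := v) (by omega) (by omega) (by simpa using h₂)
      obtain rfl : u = [] := by
        rcases List.eq_nil_or_concat u with rfl | ⟨u, e, rfl⟩
        · rfl
        exfalso
        simp only [List.concat_eq_append, List.append_assoc, List.cons_append,
          List.nil_append] at h
        have h₁ : e ≠ i + 2 := hS.ne_of_mem (p := u) h
        by_cases h₂ : e = i + 1
        · subst h₂
          apply hS.no_longest u [] (i - 1) (l := [2, 3, 1, 2, 1, 3]) (by simp)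
          convert h using 1
          simp [shiftWord]
          omega
        by_cases h₃ : e = i + 3
        · subst h₃
          have h₄ := hS.commutation_mem (p := u ++ [i + 3]) (a := i + 2) (b := i)
            (q := [i + 1, i, i + 2]) (by simpa using h) (by omega)
          have h₅ := hS.commutation_mem (p := u ++ [i + 3, i, i + 2, i + 1]) (a := i)
            (b := i + 2) (q := []) (by simpa using h₄) (by omega)
          exact hS.no_commutation_braid (p := u) (a := i + 3) (b := i) (q := []) (c := i + 2)
            (d := i + 1) (r := [i]) (by omega) (by omega) (by simpa using h₅)
        · exact hS.no_commutation_braid (p := u) (a := e) (b := i + 2) (q := []) (c := i)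
            (d := i + 1) (r := [i + 2]) (by omega) (by omega) h
      have h₁ := hS.commutation_mem (p := []) h (by omega)
      have h₂ := hS.commutation_mem (p := [i, i + 2, i + 1]) (a := i) (b := i + 2)
        (q := []) h₁ (by omega)
      have h₃ := hS.braid_mem (p := [i]) (a := i + 2) (b := i + 1) (q := [i]) h₂ (by omega)
      refine ⟨_, h₃, Or.inl ⟨i + 1, [i], [i], ?_, Or.inr (Or.inl ⟨by simp, by simp⟩)⟩⟩
      simp [add_assoc]

/-- The form `u i (i+1) i v` up to reversal and complementation, for words of integers. -/
def IntSpecialWordUpToSymmetry (N : ℤ) (x : List ℤ) : Prop :=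
  IntSpecialWord x ∨ IntSpecialWord x.reverse ∨
    IntSpecialWord (reflectWord N x) ∨ IntSpecialWord (reflectWord N x).reverse

theorem intSpecialWordUpToSymmetry_reverse {N : ℤ} {x : List ℤ} :
    IntSpecialWordUpToSymmetry N x.reverse ↔ IntSpecialWordUpToSymmetry N x := by
  have : reflectWord N x.reverse = (reflectWord N x).reverse := List.map_reverse
  simp only [IntSpecialWordUpToSymmetry, this, List.reverse_reverse]
  tauto

theorem intSpecialWordUpToSymmetry_reflectWord {N : ℤ} {x : List ℤ} :
    IntSpecialWordUpToSymmetry N (reflectWord N x) ↔ IntSpecialWordUpToSymmetry N x := by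
  simp only [IntSpecialWordUpToSymmetry, (wordSymmetry_reflectWord N).involutive x]
  tauto

/-- The letter `e` commutes with `c`, so it cannot also commute with `d` and must be the neighbour
of `d` opposite to `c`. Complementation reduces to d = c + 1. -/
theorem CircuitFreeSet.exists_special_of_braid_letter {S : Set (List ℤ)} (hS : CircuitFreeSet S)
    (N : ℤ) {c d e : ℤ} {u v : List ℤ} (h : u ++ c :: d :: c :: e :: v ∈ S)
    (hcd : c + 1 = d ∨ d + 1 = c) (hce : e + 1 < c ∨ c + 1 < e) :
    ∃ y ∈ S, IntSpecialWordUpToSymmetry N y := by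
  have hde : ¬ (e + 1 < d ∨ d + 1 < e) := fun hde => hS.no_braid_disjoint hcd hce hde h
  rcases hcd with rfl | rfl
  · obtain rfl : e = c + 2 := by omega
    obtain ⟨y, hy, h⟩ := hS.exists_special_of_factor N h
    exact ⟨y, hy, h.elim Or.inl fun h => Or.inr (Or.inr (Or.inl h))⟩
  · obtain rfl : e = d - 1 := by omega
    have hsym := wordSymmetry_reflectWord N
    obtain ⟨y, hy, h⟩ := (hS.preimage hsym).exists_special_of_factor N (i := N - (d + 1))
      (u := reflectWord N u) (v := reflectWord N v) (by
        rw [Set.mem_preimage]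
        convert h using 1
        simp [reflectWord]
        omega)
    refine ⟨_, hy, intSpecialWordUpToSymmetry_reflectWord.2 ?_⟩
    exact h.elim Or.inl fun h => Or.inr (Or.inr (Or.inl h))

/-- Disjoint factors are forbidden, and a commuting pair cannot lie inside a braid factor. So the
two overlap in one end letter, on the right after a reversal if necessary. -/
theorem CircuitFreeSet.exists_special {S : Set (List ℤ)} (hS : CircuitFreeSet S) (N : ℤ)
    {x y z : List ℤ} (hx : x ∈ S) (hy : IntBraidMove x y) (hz : IntCommutationMove x z) :
    ∃ y ∈ S, IntSpecialWordUpToSymmetry N y := by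
  obtain ⟨p₁, q₁, a, b, hab, rfl, -⟩ := hz
  obtain ⟨p₂, q₂, c, d, hcd, heq, -⟩ := hy
  simp only [List.append_assoc, List.cons_append, List.nil_append] at hx heq
  rcases List.append_eq_append_iff.1 heq with ⟨s, rfl, h⟩ | ⟨s, rfl, h⟩
  · rcases s with _ | ⟨e, _ | ⟨f, s⟩⟩
    · simp only [List.nil_append, List.cons.injEq] at h
      omega
    · simp only [List.cons_append, List.nil_append, List.cons.injEq] at h
      obtain ⟨rfl, rfl, rfl⟩ := h
      obtain ⟨y, hy, h⟩ := (hS.preimage wordSymmetry_reverse).exists_special_of_braid_letter N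
        (u := q₂.reverse) (c := b) (d := d) (e := a) (v := p₁.reverse) (by simpa using hx) hcd
        (by omega)
      exact ⟨_, hy, intSpecialWordUpToSymmetry_reverse.2 h⟩
    · simp only [List.cons_append, List.cons.injEq] at h
      obtain ⟨rfl, rfl, rfl⟩ := h
      exact absurd hx (hS.no_commutation_braid hab hcd)
  · rcases s with _ | ⟨e, _ | ⟨f, _ | ⟨g, s⟩⟩⟩
    · simp only [List.nil_append, List.cons.injEq] at h
      omega
    · simp only [List.cons_append, List.nil_append, List.cons.injEq] at h
      omega
    · simp only [List.cons_append, List.nil_append, List.cons.injEq] at h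
      obtain ⟨rfl, rfl, rfl, rfl⟩ := h
      exact hS.exists_special_of_braid_letter N (u := p₂) (c := c) (d := d) (e := b) (v := q₁)
        (by simpa using hx) hcd (by omega)
    · simp only [List.cons_append, List.cons.injEq] at h
      obtain ⟨rfl, rfl, rfl, rfl⟩ := h
      exact absurd hx (by simpa using hS.no_braid_commutation (p := p₂) (q := s) hab hcd)

/-! ### Conclusion of the classification. -/

/-- If moves of both kinds occur among the reduced words, they occur at a common word. -/
theorem exists_braidMove_commutationMove {n : ℕ} {w : Equiv.Perm (Fin (n + 1))}
    {x x' y y' : reducedWords w} (hx : CommutationMove x.1 x'.1) (hy : BraidMove y.1 y'.1) :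
    ∃ z z₁ z₂ : reducedWords w, BraidMove z.1 z₁.1 ∧ CommutationMove z.1 z₂.1 := by
  by_contra! hcon
  -- With no word admitting both kinds, every word reached from `x` admits a commutation move,
  -- including `y`.
  have key : ∀ z, Relation.ReflTransGen (fun x y : reducedWords w => Move x.1 y.1) x z →
      ∃ z' : reducedWords w, CommutationMove z.1 z'.1 := by
    intro z hz
    induction hz with
    | refl => exact ⟨x', hx⟩
    | tail _ hm ih =>
      obtain ⟨u', hu'⟩ := ih
      rcases hm with hm | hm
      · exact ⟨_, hm.symm⟩
      · exact absurd hu' (hcon _ _ _ hm)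
  obtain ⟨z', hz'⟩ := key y (reflTransGen_move x y)
  exact hcon _ _ _ hy hz'

/-- If only braid moves occurred, Matsumoto's theorem would put all words in one braid class. -/
theorem exists_commutationMove_of_card_ne_one {n : ℕ} {w : Equiv.Perm (Fin (n + 1))}
    (h : Nat.card (BraidClasses w) ≠ 1) :
    ∃ x x' : reducedWords w, CommutationMove x.1 x'.1 := by
  by_contra! hcon
  apply h
  obtain ⟨x₀⟩ : Nonempty (reducedWords w) := inferInstance
  rw [Nat.card_eq_one_iff_exists]
  refine ⟨braidClass x₀, fun B => ?_⟩
  induction B using Quotient.inductionOn with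
  | h x =>
    change braidClass x = braidClass x₀
    induction reflTransGen_move x₀ x with
    | refl => rfl
    | tail _ hm ih =>
      rw [← ih, braidClass_eq_of_braidMove (hm.resolve_left (hcon _ _))]

theorem exists_braidMove_of_card_ne_one {n : ℕ} {w : Equiv.Perm (Fin (n + 1))}
    (h : Nat.card (CommutationClasses w) ≠ 1) :
    ∃ x x' : reducedWords w, BraidMove x.1 x'.1 := by
  by_contra! hcon
  apply h
  obtain ⟨x₀⟩ : Nonempty (reducedWords w) := inferInstance
  rw [Nat.card_eq_one_iff_exists]
  refine ⟨commutationClass x₀, fun C => ?_⟩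
  induction C using Quotient.inductionOn with
  | h x =>
    change commutationClass x = commutationClass x₀
    induction reflTransGen_move x₀ x with
    | refl => rfl
    | tail _ hm ih =>
      rw [← ih, commutationClass_eq_of_commutationMove (hm.resolve_right (hcon _ _))]

theorem CircuitFree.classification {n : ℕ} {w : Equiv.Perm (Fin (n + 1))} (hw : CircuitFree w)
    (hB : Nat.card (BraidClasses w) ≠ 1) (hC : Nat.card (CommutationClasses w) ≠ 1) :
    ∃ x ∈ reducedWords w, SpecialWordUpToSymmetry x := by
  obtain ⟨x, x', hx⟩ := exists_commutationMove_of_card_ne_one hB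
  obtain ⟨y, y', hy⟩ := exists_braidMove_of_card_ne_one hC
  obtain ⟨z, z₁, z₂, h₁, h₂⟩ := exists_braidMove_commutationMove hx hy
  obtain ⟨_, ⟨v, hv, rfl⟩, h⟩ := hw.circuitFreeSet.exists_special (n + 1) ⟨z, z.2, rfl⟩
    h₁.letters h₂.letters
  exact ⟨v, hv, specialWordUpToSymmetry_iff.2 h⟩

end ReducedWords

theorem mainTheorem2 (n : ℕ) (w : Equiv.Perm (Fin (n + 1))) :
    (ReducedWords.CircuitFree w ↔ ReducedWords.AttainsLowerBound w) ∧
    (ReducedWords.AttainsLowerBound w ↔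
      (Nat.card (ReducedWords.BraidClasses w) = 1 ∨
        Nat.card (ReducedWords.CommutationClasses w) = 1 ∨
        ∃ x ∈ ReducedWords.reducedWords w, ReducedWords.SpecialWordUpToSymmetry x)) := by
  refine ⟨ReducedWords.circuitFree_iff_attainsLowerBound w, fun h => ?_, ?_⟩
  · by_contra! hcon
    obtain ⟨x, hx, hs⟩ := ((ReducedWords.circuitFree_iff_attainsLowerBound w).2 h).classification
      hcon.1 hcon.2.1
    exact hcon.2.2 x hx hs
  · rintro (h | h | ⟨x, hx, h⟩)
    · exact ReducedWords.attainsLowerBound_of_card_braidClasses h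
    · exact ReducedWords.attainsLowerBound_of_card_commutationClasses h
    · exact ReducedWords.attainsLowerBound_of_special hx h
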